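/- Let $\alpha$ be an algebraic number with primitive minimal polynomial $A(X)=a_nX^n+\cdots+a_1X+a_0\in\mathbb{Z}[X]$, all of whose complex roots have absolute value $>1$. Let $K=\mathbb{Q}(\alpha)$, let $\mathcal{O}$ be its ring of integers, and write $\alpha\mathcal{O}=\mathfrak{a}/\mathfrak{b}$ with coprime ideals $\mathfrak{a},\mathfrak{b}$ of $\mathcal{O}$. Let $$\mathbb{K}_\alpha=\prod_{\mathfrak{p}\mid\infty\text{ or }\mathfrak{p}\mid\mathfrak{b}}K_\mathfrak{p},$$ with diagonal embedding $\Phi_\alpha:K\to\mathbb{K}_\alpha$, the multiplicative action $\xi\cdot\mathbf{z}=\Phi_\alpha(\xi)\,\mathbf{z}$ of $K$, and the product measure $\mu_\alpha$ of Lebesgue measure at the infinite primes and of the Haar measures with $\mu_\mathfrak{p}(\mathcal{O}_\mathfrak{p})=1$ at the primes $\mathfrak{p}\mid\mathfrak{b}$. A collection of compact subsets of $\mathbb{K}_\alpha$ is a tiling if $\mu_\alpha$-almost every point lies in exactly one of its members. Let $\mathcal{D}\subset\mathbb{Z}[\alpha]$ be a complete set of coset representatives of $\mathbb{Z}[\alpha]/\alpha\mathbb{Z}[\alpha]$,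 let $\mathfrak{z}=\mathbb{Z}\langle\alpha,\mathcal{D}\rangle$ be the smallest $\alpha$-invariant $\mathbb{Z}$-module containing $\mathcal{D}-\mathcal{D}$, and let $\mathcal{F}\subset\mathbb{K}_\alpha$ be the non-empty compact set with $\alpha\cdot\mathcal{F}=\bigcup_{d\in\mathcal{D}}(\mathcal{F}+\Phi_\alpha(d))$. Let $D\subset\mathbb{K}_\alpha$ be a compact set such that $\{D+\Phi_\alpha(x):x\in\mathfrak{z}\}$ is a tiling. Put $\mathcal{V}_0=\{x\in\mathfrak{z}\setminus\{0\}: D\cap(D+\Phi_\alpha(x))\neq\emptyset\}$, $\mathcal{V}_k=\{x\in\mathfrak{z}\setminus\{0\}:(\alpha x+\mathcal{D})\cap(y+\mathcal{D})\neq\emptyset\text{ for some }y\in\mathcal{V}_{k-1}\}$ for $k\ge1$, and $\mathcal{V}=\bigcup_{k\ge0}\mathcal{V}_k$. Then $\mathcal{V}$ is finite. The contact matrix is $\mathbf{C}=(c_{xy})_{x,y\in\mathcal{V}}$ with $c_{xy}=\#\big((\alpha x+\mathcal{D})\cap(y+\mathcal{D})\big)$. Let $\chi_\alpha(\mathbf{z})=\prod_\mathfrak{p}\chi_\mathfrak{p}(z_\mathfrak{p})$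 on $\mathbb{K}_\alpha$, where $\chi_\mathfrak{p}(z)=\exp(-2\pi i\,\mathrm{Tr}_{K_\mathfrak{p}:\mathbb{R}}(z))$ for $\mathfrak{p}\mid\infty$ and $\chi_\mathfrak{p}(z)=\exp(2\pi i\,\lambda_p(\mathrm{Tr}_{K_\mathfrak{p}:\mathbb{Q}_p}(z)))$ for $\mathfrak{p}\mid\mathfrak{b}$, $\mathfrak{p}\mid p$, with $\lambda_p$ the $p$-adic fractional part; let $\chi_{\alpha,x}(\mathbf{z})=\chi_\alpha(x\cdot\mathbf{z})$. Let $\widehat\Omega$ be the real vector space of functions $f=\sum_{x\in\mathcal{V}}t_x\chi_{\alpha,x}:\mathbb{K}_\alpha\to\mathbb{C}$ with $t_x\in\mathbb{R}$. The $\chi_{\alpha,x}$ are linearly independent, so $F:\widehat\Omega\to\mathbb{R}^{\mathcal{V}}$, $\sum_x t_x\chi_{\alpha,x}\mapsto(t_x)_x$, is a linear isomorphism; let $\widehat{\mathbf{C}}=F^{-1}\mathbf{C}F$. Proposition. If the collection $\{\mathcal{F}+\Phi_\alpha(x):x\in\mathfrak{z}\}$ is not a tiling of $\mathbb{K}_\alpha$,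 then there is a non-constant real-valued function $f\in\widehat\Omega$ with $\widehat{\mathbf{C}}f=|a_0|\,f$. -/

import Mathlib

open scoped NumberField
open NumberField IsDedekindDomain

namespace SelfAffine

section FinitePlaces

variable {K : Type*} [Field K] [NumberField K]

/-- The rational prime `p` below a finite prime `𝔭`, i.e. `(p) = 𝔭 ∩ ℤ`. -/
noncomputable def primeBelow (v : HeightOneSpectrum (𝓞 K)) : ℕ :=
  Ideal.absNorm (Ideal.under ℤ v.asIdeal)

instance fact_primeBelow (v : HeightOneSpectrum (𝓞 K)) : Fact (primeBelow v).Prime :=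
  haveI : NeZero v.asIdeal := ⟨v.ne_bot⟩
  haveI := v.isPrime
  ⟨Nat.absNorm_under_prime v.asIdeal⟩

theorem norm_lt_one_iff (v : HeightOneSpectrum (𝓞 K)) (x : v.adicCompletion K) :
    ‖x‖ < 1 ↔ Valued.v x < 1 := by
  rw [FinitePlace.norm_def, ← (WithZeroMulInt.toNNReal_strictMono
    (HeightOneSpectrum.one_lt_absNorm_nnreal v)).lt_iff_lt, map_one]
  exact_mod_cast Iff.rfl

theorem norm_le_one_iff (v : HeightOneSpectrum (𝓞 K)) (x : v.adicCompletion K) :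
    ‖x‖ ≤ 1 ↔ Valued.v x ≤ 1 := by
  rw [FinitePlace.norm_def, ← (WithZeroMulInt.toNNReal_strictMono
    (HeightOneSpectrum.one_lt_absNorm_nnreal v)).le_iff_le, map_one]
  exact_mod_cast Iff.rfl

theorem valued_intCast_lt_one_iff (v : HeightOneSpectrum (𝓞 K)) (m : ℤ) :
    Valued.v (algebraMap ℚ (v.adicCompletion K) m) < 1 ↔ (primeBelow v : ℤ) ∣ m := by
  have h : algebraMap ℚ (v.adicCompletion K) m = (((m : 𝓞 K) : K) : v.adicCompletion K) := by
    change _ = algebraMap K (v.adicCompletion K) ((m : 𝓞 K) : K)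
    simp
  rw [h, HeightOneSpectrum.valuedAdicCompletion_eq_valuation', 
    HeightOneSpectrum.valuation_lt_one_iff_mem, Int.cast_mem_ideal_iff]
  rfl

theorem valued_intCast_le_one (v : HeightOneSpectrum (𝓞 K)) (m : ℤ) :
    Valued.v (algebraMap ℚ (v.adicCompletion K) m) ≤ 1 := by
  have h : algebraMap ℚ (v.adicCompletion K) m = (((m : 𝓞 K) : K) : v.adicCompletion K) := by
    change _ = algebraMap K (v.adicCompletion K) ((m : 𝓞 K) : K)
    simp
  rw [h, HeightOneSpectrum.valuedAdicCompletion_eq_valuation']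
  exact v.valuation_le_one _

theorem valued_ratCast_le_one (v : HeightOneSpectrum (𝓞 K)) (q : ℚ)
    (hq : ‖(q : ℚ_[primeBelow v])‖ ≤ 1) :
    Valued.v (algebraMap ℚ (v.adicCompletion K) q) ≤ 1 := by
  have hden : ¬ (primeBelow v : ℤ) ∣ (q.den : ℤ) := by
    intro hd
    have h1 : ‖((q.den : ℤ) : ℚ_[primeBelow v])‖ < 1 := Padic.norm_intCast_lt_one_iff.2 hd
    have h2 : ‖((q.num : ℤ) : ℚ_[primeBelow v])‖ < 1 := by
      have : (q.num : ℚ_[primeBelow v]) = (q : ℚ_[primeBelow v]) * ((q.den : ℤ) : ℚ_[primeBelow v]) := by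
        have := Rat.mul_den_eq_num q
        exact_mod_cast congrArg (fun r : ℚ => (r : ℚ_[primeBelow v])) this.symm
      rw [this, norm_mul]
      nlinarith [norm_nonneg ((q.den : ℤ) : ℚ_[primeBelow v]), norm_nonneg (q : ℚ_[primeBelow v])]
    have h3 := Padic.norm_intCast_lt_one_iff.1 h2
    have h4 : (primeBelow v) ∣ Nat.gcd q.num.natAbs q.den :=
      Nat.dvd_gcd (Int.natCast_dvd.1 h3) (Int.natCast_dvd_natCast.1 hd)
    rw [q.reduced] at h4
    exact (Fact.out : (primeBelow v).Prime).one_lt.ne' (Nat.dvd_one.1 h4)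
  have h1 : Valued.v (algebraMap ℚ (v.adicCompletion K) ((q.den : ℤ) : ℚ)) = 1 :=
    le_antisymm (valued_intCast_le_one v _)
      (not_lt.1 fun h => hden ((valued_intCast_lt_one_iff v _).1 h))
  have h2 : (q.num : ℚ) = q * ((q.den : ℤ) : ℚ) := by
    exact_mod_cast (Rat.mul_den_eq_num q).symm
  have h3 := valued_intCast_le_one v q.num
  rwa [h2, map_mul, map_mul, h1, mul_one] at h3

/-- `ℚ` with the topology given by its `p`-adic valuation, mapped to `K_𝔭`. -/
noncomputable def ratToCompletion (v : HeightOneSpectrum (𝓞 K)) :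
    WithVal (Rat.padicValuation (primeBelow v)) →+* v.adicCompletion K :=
  (algebraMap ℚ (v.adicCompletion K)).comp
    (WithVal.equiv (Rat.padicValuation (primeBelow v))).toRingHom

theorem uniformContinuous_ratToCompletion (v : HeightOneSpectrum (𝓞 K)) :
    UniformContinuous (ratToCompletion v) := by
  refine uniformContinuous_of_continuousAt_zero (ratToCompletion v).toAddMonoidHom ?_
  have hpp : (primeBelow v).Prime := Fact.out
  have hp : (0 : ℝ) < primeBelow v := by exact_mod_cast hpp.pos
  have hb := (Metric.nhds_basis_ball (x := (0 : ℚ_[primeBelow v]))).comap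
    ((Rat.castHom ℚ_[primeBelow v]).comp
      (WithVal.equiv (Rat.padicValuation (primeBelow v))).toRingHom)
  have hn := (Padic.isUniformInducing_cast_withVal (p := primeBelow v)).isInducing.nhds_eq_comap 0
  rw [map_zero] at hn
  rw [ContinuousAt, hn]
  change Filter.Tendsto (ratToCompletion v) _ (nhds (ratToCompletion v 0))
  rw [map_zero]
  refine (hb.tendsto_iff Metric.nhds_basis_ball).2 fun ε hε => ?_
  set P : v.adicCompletion K := algebraMap ℚ _ ((primeBelow v : ℤ) : ℚ) with hP
  have hP1 : ‖P‖ < 1 := (norm_lt_one_iff v _).2 ((valued_intCast_lt_one_iff v _).2 dvd_rfl)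
  obtain ⟨n, hn⟩ := exists_pow_lt_of_lt_one hε hP1
  refine ⟨((primeBelow v : ℝ) ^ n)⁻¹, by positivity, fun q hq => ?_⟩
  set r : ℚ := WithVal.equiv (Rat.padicValuation (primeBelow v)) q with hr
  have hq' : ‖(r : ℚ_[primeBelow v])‖ < ((primeBelow v : ℝ) ^ n)⁻¹ := by
    simpa [hr] using hq
  have hp0 : ((primeBelow v : ℤ) : ℚ) ≠ 0 := by exact_mod_cast hpp.ne_zero
  set s : ℚ := r / ((primeBelow v : ℤ) : ℚ) ^ n with hs
  have hrs : r = ((primeBelow v : ℤ) : ℚ) ^ n * s := by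
    rw [hs]; field_simp
  have hs1 : ‖(s : ℚ_[primeBelow v])‖ ≤ 1 := by
    have : ‖(r : ℚ_[primeBelow v])‖ = ((primeBelow v : ℝ) ^ n)⁻¹ * ‖(s : ℚ_[primeBelow v])‖ := by
      rw [hrs]; push_cast; rw [norm_mul, norm_pow, Padic.norm_p, inv_pow]
    rw [this] at hq'
    have h0 : (0 : ℝ) < ((primeBelow v : ℝ) ^ n)⁻¹ := by positivity
    nlinarith
  have h1 : ratToCompletion v q = P ^ n * algebraMap ℚ _ s := by
    change algebraMap ℚ (v.adicCompletion K) r = _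
    rw [hrs, map_mul, map_pow]
  have h2 : ‖algebraMap ℚ (v.adicCompletion K) s‖ ≤ 1 :=
    (norm_le_one_iff v _).2 (valued_ratCast_le_one v s hs1)
  rw [mem_ball_zero_iff, h1, norm_mul, norm_pow]
  calc ‖P‖ ^ n * ‖algebraMap ℚ (v.adicCompletion K) s‖ ≤ ‖P‖ ^ n * 1 := by gcongr
    _ < ε := by rwa [mul_one]

/-- The embedding `ℚ_p → K_𝔭` of the completion of `ℚ` at the prime below `𝔭`: the continuous
extension of `ℚ → K_𝔭`. -/
noncomputable def padicToCompletion (v : HeightOneSpectrum (𝓞 K)) :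
    ℚ_[primeBelow v] →+* v.adicCompletion K :=
  IsDenseInducing.extendRingHom
    (i := (Rat.castHom ℚ_[primeBelow v]).comp
      (WithVal.equiv (Rat.padicValuation (primeBelow v))).toRingHom)
    (f := ratToCompletion v)
    Padic.isUniformInducing_cast_withVal
    Padic.isDenseInducing_cast_withVal.dense
    (uniformContinuous_ratToCompletion v)

/-- The local trace `Tr_{K_𝔭 : ℚ_p}`. -/
noncomputable def localTrace (v : HeightOneSpectrum (𝓞 K)) (z : v.adicCompletion K) :
    ℚ_[primeBelow v] :=
  letI := (padicToCompletion v).toAlgebra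
  Algebra.trace ℚ_[primeBelow v] (v.adicCompletion K) z

theorem finite_residueField (v : HeightOneSpectrum (𝓞 K)) :
    Finite (IsLocalRing.ResidueField (v.adicCompletionIntegers K)) := by
  let φ : 𝓞 K →+* IsLocalRing.ResidueField (v.adicCompletionIntegers K) :=
    (IsLocalRing.residue (v.adicCompletionIntegers K)).comp
      (algebraMap (𝓞 K) (v.adicCompletionIntegers K))
  have hmem : ∀ y : v.adicCompletionIntegers K, Valued.v (y : v.adicCompletion K) < 1 →
      IsLocalRing.residue (v.adicCompletionIntegers K) y = 0 := by
    intro y hy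
    rw [IsLocalRing.residue_eq_zero_iff]
    exact (Valuation.mem_maximalIdeal_iff (v.adicCompletion K) Valued.v).2 hy
  have hker : ∀ a ∈ v.asIdeal, φ a = 0 := by
    intro a ha
    refine hmem _ ?_
    change Valued.v (((a : K)) : v.adicCompletion K) < 1
    rw [HeightOneSpectrum.valuedAdicCompletion_eq_valuation']
    exact (v.valuation_lt_one_iff_mem a).2 ha
  have : Finite (𝓞 K ⧸ v.asIdeal) := v.asIdeal.finiteQuotientOfFreeOfNeBot v.ne_bot
  refine Finite.of_surjective (Ideal.Quotient.lift v.asIdeal φ hker) fun y => ?_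
  obtain ⟨y, rfl⟩ := IsLocalRing.residue_surjective y
  obtain ⟨k, hk⟩ : ∃ k : K, Valued.v ((k : v.adicCompletion K) - y) < 1 := by
    obtain ⟨k, hk⟩ := (v.denseRange_algebraMap K).exists_dist_lt (y : v.adicCompletion K) one_pos
    rw [dist_comm, dist_eq_norm, norm_lt_one_iff] at hk
    exact ⟨k, hk⟩
  have hk1 : v.valuation K k ≤ 1 := by
    rw [← HeightOneSpectrum.valuedAdicCompletion_eq_valuation' v k]
    have := Valued.v.map_add ((k : v.adicCompletion K) - y) y
    rw [sub_add_cancel] at this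
    exact this.trans (max_le hk.le y.2)
  obtain ⟨a, ha⟩ := v.exists_valuation_sub_lt_of_integer hk1 1
  refine ⟨Ideal.Quotient.mk _ a, ?_⟩
  rw [Ideal.Quotient.lift_mk, ← sub_eq_zero]
  change IsLocalRing.residue _ (algebraMap (𝓞 K) (v.adicCompletionIntegers K) a) - _ = 0
  rw [← map_sub]
  refine hmem _ ?_
  have h2 : ((algebraMap (𝓞 K) (v.adicCompletionIntegers K) a - y : v.adicCompletionIntegers K) :
      v.adicCompletion K) = (((a : K) - k : K) : v.adicCompletion K) + ((k : v.adicCompletion K) - y) := by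
    change algebraMap K (v.adicCompletion K) (a : K) - y =
      algebraMap K (v.adicCompletion K) ((a : K) - k) + (algebraMap K (v.adicCompletion K) k - y)
    rw [map_sub]
    ring
  rw [h2]
  refine (Valued.v.map_add _ _).trans_lt (max_lt ?_ hk)
  rw [HeightOneSpectrum.valuedAdicCompletion_eq_valuation']
  simpa using ha

theorem isCompact_integers (v : HeightOneSpectrum (𝓞 K)) :
    IsCompact (v.adicCompletionIntegers K : Set (v.adicCompletion K)) := by
  have hfin := finite_residueField v
  have hclosed : IsClosed (v.adicCompletionIntegers K : Set (v.adicCompletion K)) :=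
    Valued.isClosed_valuationSubring _
  have h := (Valued.integer.compactSpace_iff_completeSpace_and_isDiscreteValuationRing_and_finite_residueField
    (K := v.adicCompletion K)).2 ⟨hclosed.isComplete.completeSpace_coe, 
      inferInstanceAs (IsDiscreteValuationRing (v.adicCompletionIntegers K)), hfin⟩
  exact isCompact_iff_compactSpace.2 h

/-- The ring of integers `𝒪_𝔭` of `K_𝔭`, as a compact set with nonempty interior. -/
noncomputable def integersCompacts (v : HeightOneSpectrum (𝓞 K)) :
    TopologicalSpace.PositiveCompacts (v.adicCompletion K) where
  carrier := v.adicCompletionIntegers K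
  isCompact' := isCompact_integers v
  interior_nonempty' := by
    have h : IsOpen (v.adicCompletionIntegers K : Set (v.adicCompletion K)) :=
      Valued.isOpen_valuationSubring _
    rw [h.interior_eq]
    exact ⟨0, zero_mem _⟩

noncomputable instance measurableSpaceCompletion (v : HeightOneSpectrum (𝓞 K)) :
    MeasurableSpace (v.adicCompletion K) := borel _

instance borelSpaceCompletion (v : HeightOneSpectrum (𝓞 K)) :
    BorelSpace (v.adicCompletion K) := ⟨rfl⟩

/-- The Haar measure `μ_𝔭` on `K_𝔭`, normalized by `μ_𝔭(𝒪_𝔭) = 1` (equivalently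
`μ_𝔭(a + 𝔭^k) = 𝔑(𝔭)^{-k}`). -/
noncomputable def haarCompletion (v : HeightOneSpectrum (𝓞 K)) :
    MeasureTheory.Measure (v.adicCompletion K) :=
  MeasureTheory.Measure.addHaarMeasure (integersCompacts v)

end FinitePlaces

theorem padic_shift_norm_le {p : ℕ} [Fact p.Prime] (x : ℚ_[p]) :
    ‖(p : ℚ_[p]) ^ (-x.valuation).toNat * x‖ ≤ 1 := by
  rcases eq_or_ne x 0 with rfl | hx
  · simp
  have hp : (p : ℚ_[p]) ≠ 0 := by exact_mod_cast (Fact.out : p.Prime).ne_zero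
  rw [Padic.norm_le_one_iff_val_nonneg, Padic.valuation_mul (pow_ne_zero _ hp) hx,
    Padic.valuation_pow, Padic.valuation_p]
  have := Int.self_le_toNat (-x.valuation)
  linarith

/-- The fractional part `λ_p(x) = ∑_{j=-k}^{-1} b_j p^j` of `x = ∑_{j ≥ -k} b_j p^j ∈ ℚ_p`: with `k` such that
`p^k x ∈ ℤ_p`, it is `m / p^k`, where `0 ≤ m < p^k` and `m ≡ p^k x` modulo `p^k ℤ_p`. -/
noncomputable def padicFract {p : ℕ} [Fact p.Prime] (x : ℚ_[p]) : ℚ :=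
  (PadicInt.appr ⟨(p : ℚ_[p]) ^ (-x.valuation).toNat * x, padic_shift_norm_le x⟩
    (-x.valuation).toNat : ℚ) / (p : ℚ) ^ (-x.valuation).toNat

theorem padicFract_zero {p : ℕ} [Fact p.Prime] : padicFract (0 : ℚ_[p]) = 0 := by
  simp [padicFract, PadicInt.appr]

open MeasureTheory NumberField.mixedEmbedding

section RepresentationSpace

variable {K : Type*} [Field K] [NumberField K]

/-- The finite primes `𝔭 ∣ 𝔟`, where `α 𝒪 = 𝔞 / 𝔟` with coprime ideals `𝔞, 𝔟`: these are the
primes that occur with a negative exponent in the factorization of `α 𝒪`, i.e. at which the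
(multiplicative) `𝔭`-adic valuation of `α` exceeds `1`. -/
abbrev DenomPrime (α : K) : Type _ := {v : HeightOneSpectrum (𝓞 K) // 1 < v.valuation K α}

noncomputable instance fintypeDenomPrime (α : K) : Fintype (DenomPrime α) :=
  (HeightOneSpectrum.Support.finite (𝓞 K) α).fintype

/-- The representation space `𝕂_α = 𝕂_∞ × 𝕂_𝔟`. Here `𝕂_∞ = ℝ^r × ℂ^s` is Mathlib's
`mixedSpace K`, the product of the completions of `K` at the infinite primes. -/
abbrev RepSpace (α : K) : Type _ :=
  mixedSpace K × ((v : DenomPrime α) → v.1.adicCompletion K)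

/-- The diagonal ring homomorphism `Φ_α : K → 𝕂_α`. -/
noncomputable def diag (α : K) : K →+* RepSpace α :=
  (mixedEmbedding K).prod (RingHom.pi fun v => algebraMap K (v.1.adicCompletion K))

open scoped Classical in
/-- The measure `μ_α` on `𝕂_α`: the product of Lebesgue measure on `𝕂_∞` and of the normalized
Haar measures `μ_𝔭`, `𝔭 ∣ 𝔟`. -/
noncomputable def repMeasure (α : K) : Measure (RepSpace α) :=
  (volume : Measure (mixedSpace K)).prod (Measure.pi fun v : DenomPrime α => haarCompletion v.1)

end RepresentationSpace

section Tilings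

/-- A collection `C` of compact subsets of `X` is a multiple tiling of multiplicity `m ≥ 1` if
almost every point of `X` is contained in exactly `m` elements of `C`. -/
def IsMultipleTiling {X : Type*} [TopologicalSpace X] [MeasurableSpace X] (μ : Measure X)
    (C : Set (Set X)) (m : ℕ) : Prop :=
  0 < m ∧ (∀ S ∈ C, IsCompact S) ∧ ∀ᵐ z ∂μ, {S | S ∈ C ∧ z ∈ S}.encard = m

/-- A tiling is a multiple tiling of multiplicity `1`. -/
def IsTiling {X : Type*} [TopologicalSpace X] [MeasurableSpace X] (μ : Measure X)
    (C : Set (Set X)) : Prop :=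
  IsMultipleTiling μ C 1

end Tilings

section Tiles

variable {K : Type*} [Field K] [NumberField K]

/-- `A` is the primitive minimal polynomial of `α` in `ℤ[X]` (it is unique up to sign). -/
def IsPrimitiveMinpoly (A : Polynomial ℤ) (α : K) : Prop :=
  A.IsPrimitive ∧ Irreducible A ∧ Polynomial.aeval α A = 0

/-- All complex roots of `A` lie outside the closed unit disc. -/
def IsExpanding (A : Polynomial ℤ) : Prop :=
  ∀ z : ℂ, Polynomial.aeval z A = 0 → 1 < ‖z‖

/-- `𝒟` is a standard digit set for `α`: a complete set of coset representatives of
`ℤ[α] / α ℤ[α]`. -/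
def IsStandardDigitSet (α : K) (𝒟 : Set K) : Prop :=
  (∀ d ∈ 𝒟, d ∈ Algebra.adjoin ℤ {α}) ∧
    ∀ x ∈ Algebra.adjoin ℤ {α}, ∃! d, d ∈ 𝒟 ∧ ∃ y ∈ Algebra.adjoin ℤ {α}, x - d = α * y

/-- `ℤ⟨α, 𝒟⟩`: the smallest `α`-invariant `ℤ`-submodule containing `𝒟 - 𝒟`. -/
def digitModule (α : K) (𝒟 : Set K) : Submodule ℤ K :=
  sInf {M | (∀ d ∈ 𝒟, ∀ d' ∈ 𝒟, d - d' ∈ M) ∧ ∀ x ∈ M, α * x ∈ M}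

/-- The translate `F + Φ_α(x)`. -/
def translate (α : K) (F : Set (RepSpace α)) (x : K) : Set (RepSpace α) :=
  (fun z => z + diag α x) '' F

/-- The collection `{F + Φ_α(x) : x ∈ ℤ⟨α, 𝒟⟩}`. -/
def translates (α : K) (𝒟 : Set K) (F : Set (RepSpace α)) : Set (Set (RepSpace α)) :=
  translate α F '' (digitModule α 𝒟 : Set K)

/-- `F = 𝓕(α, 𝒟)`: the nonempty compact set with `α · F = ⋃_{d ∈ 𝒟} (F + Φ_α(d))`. -/
def IsSelfAffineTile (α : K) (𝒟 : Set K) (F : Set (RepSpace α)) : Prop :=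
  F.Nonempty ∧ IsCompact F ∧ (fun z => diag α α * z) '' F = ⋃ d ∈ 𝒟, translate α F d

end Tiles

section Contact

variable {K : Type*} [Field K] [NumberField K]

/-- The sets `𝒱_k`, starting from the neighbours of the compact set `D`. -/
def contactStep (α : K) (𝒟 : Set K) (D : Set (RepSpace α)) : ℕ → Set K
  | 0 => {x | x ∈ digitModule α 𝒟 ∧ x ≠ 0 ∧ (D ∩ translate α D x).Nonempty}
  | k + 1 => {x | x ∈ digitModule α 𝒟 ∧ x ≠ 0 ∧ ∃ y ∈ contactStep α 𝒟 D k,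
      (((fun d => α * x + d) '' 𝒟) ∩ ((fun d => y + d) '' 𝒟)).Nonempty}

/-- The index set `𝒱 = ⋃_k 𝒱_k` of the contact matrix. -/
def contactSet (α : K) (𝒟 : Set K) (D : Set (RepSpace α)) : Set K :=
  ⋃ k, contactStep α 𝒟 D k

/-- The contact matrix `c_{xy} = #((α x + 𝒟) ∩ (y + 𝒟))`, `x, y ∈ V`. -/
noncomputable def contactMatrix (α : K) (𝒟 V : Set K) : Matrix V V ℝ :=
  Matrix.of fun x y => ((((fun d => α * (x : K) + d) '' 𝒟) ∩ ((fun d => (y : K) + d) '' 𝒟)).ncard : ℝ)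

end Contact

section Fourier

variable {K : Type*} [Field K] [NumberField K]

open scoped Classical in
/-- The product over the infinite primes of the characters
`χ_𝔭(z) = exp(-2πi Tr_{K_𝔭 : ℝ}(z))`. -/
noncomputable def charInfinite (z : mixedSpace K) : ℂ :=
  (∏ w, Complex.exp (-2 * Real.pi * Complex.I * (z.1 w : ℂ))) *
    ∏ w, Complex.exp (-2 * Real.pi * Complex.I * (Algebra.trace ℝ ℂ (z.2 w) : ℂ))

/-- The character `χ_𝔭(z) = exp(2πi λ_p(Tr_{K_𝔭 : ℚ_p}(z)))` for a finite prime `𝔭`. -/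
noncomputable def charFinite (v : HeightOneSpectrum (𝓞 K)) (z : v.adicCompletion K) : ℂ :=
  Complex.exp (2 * Real.pi * Complex.I * (padicFract (localTrace v z) : ℂ))

/-- The character `χ_α` of `𝕂_α`. -/
noncomputable def charRep (α : K) (z : RepSpace α) : ℂ :=
  charInfinite z.1 * ∏ v, charFinite v.1 (z.2 v)

/-- The character `χ_{α,ξ}(z) = χ_α(ξ · z)`. -/
noncomputable def charTwist (α ξ : K) (z : RepSpace α) : ℂ :=
  charRep α (diag α ξ * z)

/-- `F⁻¹ : Ω = ℝ^V → (𝕂_α → ℂ)`, `(t_x) ↦ ∑_{x ∈ V} t_x χ_{α,x}`. -/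
noncomputable def fourierInv (α : K) (V : Set K) [Fintype V] :
    (V → ℝ) →ₗ[ℝ] (RepSpace α → ℂ) where
  toFun t := fun z => ∑ x : V, (t x : ℂ) * charTwist α x z
  map_add' s t := by
    funext z; simp [add_mul, Finset.sum_add_distrib]
  map_smul' c t := by
    funext z; simp [Finset.mul_sum, mul_assoc]

theorem charInfinite_add (a b : mixedSpace K) :
    charInfinite (a + b) = charInfinite a * charInfinite b := by
  simp only [charInfinite, mul_add, Prod.fst_add, Prod.snd_add, Pi.add_apply,
    map_add, Complex.ofReal_add, Complex.exp_add, Finset.prod_mul_distrib]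
  ring

theorem charInfinite_zero : charInfinite (0 : mixedSpace K) = 1 := by
  simp [charInfinite]

theorem charInfinite_smul_one (s : ℝ) :
    charInfinite (s • (1 : mixedSpace K)) =
      Complex.exp (-2 * Real.pi * Complex.I * (s * Module.finrank ℚ K)) := by
  have h := InfinitePlace.card_add_two_mul_card_eq_rank K
  rw [← h]
  simp only [charInfinite, Prod.smul_fst, Prod.smul_snd, Pi.smul_apply, Prod.fst_one,
    Prod.snd_one, Pi.one_apply, Algebra.trace_complex_apply, Finset.prod_const, ← Complex.exp_nat_mul,
    ← Complex.exp_add, Finset.card_univ]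
  congr 1
  simp [InfinitePlace.nrRealPlaces, InfinitePlace.nrComplexPlaces]
  ring

/-- The infinite part of `χ_{α,ξ}` as a homomorphism. -/
noncomputable def charInfiniteHom (ξ : K) : Multiplicative (mixedSpace K) →* ℂ where
  toFun z := charInfinite (mixedEmbedding K ξ * z.toAdd)
  map_one' := by simp [charInfinite_zero]
  map_mul' a b := by
    simp [mul_add, charInfinite_add]

theorem charInfiniteHom_injective :
    Function.Injective (charInfiniteHom : K → Multiplicative (mixedSpace K) →* ℂ) := by
  intro ξ η h
  by_contra hne
  have hn : (Module.finrank ℚ K : ℝ) ≠ 0 := by exact_mod_cast Module.finrank_pos.ne'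
  have hsub : ξ - η ≠ 0 := sub_ne_zero.2 hne
  set s : ℝ := (2 * Module.finrank ℚ K)⁻¹ with hs
  set z : mixedSpace K := s • mixedEmbedding K (ξ - η)⁻¹ with hz
  have h1 : charInfinite (mixedEmbedding K ξ * z) = charInfinite (mixedEmbedding K η * z) :=
    DFunLike.congr_fun h (Multiplicative.ofAdd z)
  have h2 : mixedEmbedding K ξ * z = s • (1 : mixedSpace K) + mixedEmbedding K η * z := by
    have : mixedEmbedding K (ξ - η) * z = s • (1 : mixedSpace K) := by
      rw [hz, mul_smul_comm, ← map_mul, mul_inv_cancel₀ hsub, map_one]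
    rw [← this, map_sub]
    ring
  have h3 : charInfinite (mixedEmbedding K η * z) ≠ 0 := by
    intro h0
    have h4 := charInfinite_add (mixedEmbedding K η * z) (-(mixedEmbedding K η * z))
    rw [h0, add_neg_cancel, charInfinite_zero, zero_mul] at h4
    exact one_ne_zero h4
  rw [h2, charInfinite_add] at h1
  have h5 : charInfinite (s • (1 : mixedSpace K)) = 1 := by
    have := mul_right_cancel₀ h3 (h1.trans (one_mul _).symm)
    exact this
  rw [charInfinite_smul_one] at h5
  have hnC : (Module.finrank ℚ K : ℂ) ≠ 0 := by exact_mod_cast hn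
  have h6 : -2 * Real.pi * Complex.I * ((s : ℂ) * Module.finrank ℚ K) = -(Real.pi * Complex.I) := by
    rw [hs]; push_cast; field_simp
  rw [h6, Complex.exp_neg, Complex.exp_pi_mul_I] at h5
  norm_num at h5

theorem charTwist_infinite (α ξ : K) (z : mixedSpace K) :
    charTwist α ξ (z, 0) = charInfiniteHom ξ (Multiplicative.ofAdd z) := by
  simp [charTwist, charRep, charInfiniteHom, charFinite, localTrace, padicFract_zero, diag]

/-- The characters `χ_{α,x}` are linearly independent, so the coefficients `t_x` are determined by
the function `∑ t_x χ_{α,x}`. -/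
theorem fourierInv_injective (α : K) (V : Set K) [Fintype V] :
    Function.Injective (fourierInv α V) := by
  rw [← LinearMap.ker_eq_bot, LinearMap.ker_eq_bot']
  intro t ht
  have hli := (linearIndependent_monoidHom (Multiplicative (mixedSpace K)) ℂ).comp
    (fun x : V => (charInfiniteHom (x : K)))
    (charInfiniteHom_injective.comp Subtype.val_injective)
  rw [Fintype.linearIndependent_iff] at hli
  funext x
  have := hli (fun x => (t x : ℂ)) (by
    funext z
    have h := congrFun ht (z.toAdd, 0)
    simp only [fourierInv, LinearMap.coe_mk, AddHom.coe_mk, charTwist_infinite] at h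
    simpa using h) x
  exact_mod_cast this

/-- The space `Ω̂` of functions `∑_{x ∈ V} t_x χ_{α,x}` on `𝕂_α` with real coefficients `t_x`. -/
noncomputable def OmegaHat (α : K) (V : Set K) [Fintype V] : Submodule ℝ (RepSpace α → ℂ) :=
  LinearMap.range (fourierInv α V)

/-- The Fourier transform `F : Ω̂ → Ω`, `∑ t_x χ_{α,x} ↦ (t_x)`. -/
noncomputable def fourierCoeffs (α : K) (V : Set K) [Fintype V] : OmegaHat α V ≃ₗ[ℝ] (V → ℝ) :=
  (LinearEquiv.ofInjective (fourierInv α V) (fourierInv_injective α V)).symm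

/-- The Fourier transform `Ĉ = F⁻¹ C F` of the contact matrix. -/
noncomputable def contactHat (α : K) (𝒟 V : Set K) [Fintype V] : OmegaHat α V →ₗ[ℝ] OmegaHat α V :=
  (fourierCoeffs α V).symm.toLinearMap ∘ₗ (contactMatrix α 𝒟 V).mulVecLin ∘ₗ (fourierCoeffs α V).toLinearMap

end Fourier

end SelfAffine

open SelfAffine

/-!
Let `q = |a₀| = #𝒟`. The columns of the contact matrix `C` sum to at most `q`, so if `C t = q t`
with `t ≠ 0` then also `C |t| = q |t|`. Symmetrising `|t|` under `x ↦ -x`, which preserves `C`,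
gives a nonzero even eigenvector, whose function in `Ω̂` is real-valued. That function is not
constant because `0 ∉ 𝒱` and distinct characters are linearly independent.

If `q` is not an eigenvalue of `C`, let `p_n(y)` be the proportion of the sums
`d₀ + α d₁ + ⋯ + α^(n-1) d_(n-1)` with digits in `𝒟` that cease to be such sums after translation by
`y`. On `𝒱` these satisfy `p_(n+1) ≤ q⁻¹ p_n C`, and as `q` is not an eigenvalue this forces
`p_n(y) → 0`. The `y ∈ 𝔷` with `p_n(y) → 0` form an `α`-stable group `H` containing every `x ∈ 𝔷`
for which `D` meets `D + Φ_α(x)`, so `H + D` is open and closed, hence a union of cosets of the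
connected factor `𝕂_∞`. Moreover `H` is cocompact in `𝕂_α`, and a cocompact subgroup of the
product of the `K_𝔭` with `𝔭 ∣ 𝔟` is dense. Therefore `H + D = 𝕂_α`, that is, `H = 𝔷`.

For `0 ≠ y ∈ 𝔷` and `n` large, some `n`-digit sum thus remains an `n`-digit sum after translation by
`y`. The translates of `F` by the `n`-digit sums cover `α^n F` without overlap, so `F` and
`F + Φ_α(y)` overlap in a null set. As the translates of `F` by `𝔷` also cover `𝕂_α`, they form a
tiling.
-/

namespace SelfAffine

open Filter Topology MeasureTheory NumberField.mixedEmbedding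
open scoped Pointwise

section DigitSums

variable {G : Type*} [AddCommGroup G]

/-- `E` is a complete system of digits for the injective endomorphism `T` acting on the group `Λ`:
with one digit subtracted from all of them, the digits represent every class of `Λ / T Λ` exactly
once. The digits need not lie in `Λ`, only their differences. -/
structure IsDigitSystem (T : G →+ G) (E : Finset G) (Λ : AddSubgroup G) : Prop where
  injective : Function.Injective T
  nonempty : E.Nonempty
  map_mem : ∀ x ∈ Λ, T x ∈ Λ
  sub_mem : ∀ d ∈ E, ∀ d' ∈ E, d - d' ∈ Λ
  exists_digit : ∀ x ∈ Λ, ∀ d' ∈ E, ∃ d ∈ E, ∃ y ∈ Λ, x + d' = d + T y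
  digit_unique : ∀ d ∈ E, ∀ d' ∈ E, ∀ y ∈ Λ, d - d' = T y → d = d'

variable {T : G →+ G} {E : Finset G} {Λ : AddSubgroup G}

theorem IsDigitSystem.eq_and_eq_of_add_map_eq (h : IsDigitSystem T E Λ) {d d' y y' : G} (hd : d ∈ E)
    (hd' : d' ∈ E) (hy : y - y' ∈ Λ) (heq : d + T y = d' + T y') : d = d' ∧ y = y' := by
  obtain rfl : d = d' := h.digit_unique d hd d' hd' (y' - y) (by simpa using Λ.neg_mem hy)
    (by rw [map_sub, sub_eq_sub_iff_add_eq_add, heq, add_comm])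
  exact ⟨rfl, h.injective (add_left_cancel heq)⟩

variable [DecidableEq G]

/-- The set of the sums `d₀ + T d₁ + ⋯ + T^(n-1) d_(n-1)` with digits `dⱼ ∈ E`. -/
def digitSums (T : G →+ G) (E : Finset G) : ℕ → Finset G
  | 0 => {0}
  | n + 1 => E + (digitSums T E n).image T

/-- The number of `n`-digit sums that leave the set of `n`-digit sums when translated by `y`. -/
def exitCount (T : G →+ G) (E : Finset G) (n : ℕ) (y : G) : ℕ :=
  ((digitSums T E n).filter fun e => e + y ∉ digitSums T E n).card

theorem mem_digitSums_succ {n : ℕ} {x : G} :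
    x ∈ digitSums T E (n + 1) ↔ ∃ d ∈ E, ∃ e ∈ digitSums T E n, d + T e = x := by
  simp [digitSums, Finset.mem_add]

namespace IsDigitSystem

theorem sub_mem_of_mem_digitSums (h : IsDigitSystem T E Λ) {n : ℕ} {e e' : G}
    (he : e ∈ digitSums T E n) (he' : e' ∈ digitSums T E n) : e - e' ∈ Λ := by
  induction n generalizing e e' with
  | zero => simp_all [digitSums]
  | succ n ih =>
    obtain ⟨d, hd, f, hf, rfl⟩ := mem_digitSums_succ.1 he
    obtain ⟨d', hd', f', hf', rfl⟩ := mem_digitSums_succ.1 he'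
    rw [add_sub_add_comm, ← map_sub]
    exact Λ.add_mem (h.sub_mem d hd d' hd') (h.map_mem _ (ih hf hf'))

theorem card_digitSums (h : IsDigitSystem T E Λ) (n : ℕ) :
    (digitSums T E n).card = E.card ^ n := by
  induction n with
  | zero => simp [digitSums]
  | succ n ih =>
    rw [digitSums, pow_succ', ← ih, ← Finset.card_image_of_injective (digitSums T E n) h.injective]
    refine Finset.card_add_iff.2 ?_
    simp only [Set.InjOn, Set.mem_prod, Finset.coe_image, Prod.forall]
    rintro d _ ⟨hd, e, he, rfl⟩ d' _ ⟨hd', e', he', rfl⟩ heq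
    obtain ⟨rfl, rfl⟩ := h.eq_and_eq_of_add_map_eq hd hd' (h.sub_mem_of_mem_digitSums he he') heq
    rfl

end IsDigitSystem

theorem exitCount_zero_right (n : ℕ) : exitCount T E n 0 = 0 := by
  simp [exitCount, Finset.filter_eq_empty_iff]

theorem exitCount_add_le (n : ℕ) (y z : G) :
    exitCount T E n (y + z) ≤ exitCount T E n y + exitCount T E n z := by
  set S := digitSums T E n
  have hsub : S.filter (fun e => e + (y + z) ∉ S) ⊆ S.filter (fun e => e + y ∉ S) ∪
      (S.filter (fun e => e + z ∉ S)).image (fun e => e - y) := by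
    intro e he
    rw [Finset.mem_filter] at he
    by_cases hy : e + y ∈ S
    · refine Finset.mem_union_right _ (Finset.mem_image.2 ⟨e + y, ?_, by abel⟩)
      exact Finset.mem_filter.2 ⟨hy, by rw [add_assoc]; exact he.2⟩
    · exact Finset.mem_union_left _ (Finset.mem_filter.2 ⟨he.1, hy⟩)
  exact (Finset.card_le_card hsub).trans ((Finset.card_union_le _ _).trans
    (Nat.add_le_add_left Finset.card_image_le _))

theorem exitCount_neg (n : ℕ) (y : G) : exitCount T E n (-y) = exitCount T E n y := by
  set S := digitSums T E n
  have hsplit (z : G) : (S.filter fun e => e + z ∈ S).card + exitCount T E n z = S.card :=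
    Finset.card_filter_add_card_filter_not _
  have hstay : (S.filter fun e => e + y ∈ S).card = (S.filter fun e => e + -y ∈ S).card := by
    refine Finset.card_bij' (fun e _ => e + y) (fun e _ => e + -y) ?_ ?_ ?_ ?_ <;>
      simp +contextual
  have := hsplit y
  have := hsplit (-y)
  omega

theorem exitCount_map_le (n : ℕ) (y : G) :
    exitCount T E (n + 1) (T y) ≤ E.card * exitCount T E n y := by
  have hsub : (digitSums T E (n + 1)).filter (fun e => e + T y ∉ digitSums T E (n + 1)) ⊆
      Finset.image₂ (fun d e => d + T e) E
        ((digitSums T E n).filter fun e => e + y ∉ digitSums T E n) := by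
    intro x hx
    obtain ⟨hx, hxy⟩ := Finset.mem_filter.1 hx
    obtain ⟨d, hd, e, he, rfl⟩ := mem_digitSums_succ.1 hx
    refine Finset.mem_image₂.2 ⟨d, hd, e, Finset.mem_filter.2 ⟨he, fun h => hxy ?_⟩, rfl⟩
    exact mem_digitSums_succ.2 ⟨d, hd, e + y, h, by rw [map_add, add_assoc]⟩
  exact (Finset.card_le_card hsub).trans (Finset.card_image₂_le _ _ _)

/-- The elements `y` such that the proportion of the `n`-digit sums that leave the set of `n`-digit
sums when translated by `y` tends to zero as `n → ∞`. -/
noncomputable def almostStabilizer (T : G →+ G) (E : Finset G) : AddSubgroup G where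
  carrier := {y | Tendsto (fun n => (exitCount T E n y : ℝ) / (E.card : ℝ) ^ n) atTop (𝓝 0)}
  zero_mem' := by simp [exitCount_zero_right]
  add_mem' := by
    intro y z hy hz
    refine squeeze_zero (fun n => by positivity) (fun n => ?_) (by simpa using hy.add hz)
    rw [← add_div]
    gcongr
    exact_mod_cast exitCount_add_le n y z
  neg_mem' := by simp only [Set.mem_ofPred_eq, exitCount_neg, imp_self, implies_true]

theorem map_mem_almostStabilizer {y : G} (hy : y ∈ almostStabilizer T E) :
    T y ∈ almostStabilizer T E := by
  refine (tendsto_add_atTop_iff_nat 1).1 (squeeze_zero (fun n => by positivity) (fun n => ?_) hy)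
  rcases E.eq_empty_or_nonempty with rfl | hE
  · simp only [Finset.card_empty, pow_succ, CharP.cast_eq_zero, mul_zero, div_zero]
    positivity
  have hq : (0 : ℝ) < E.card := by exact_mod_cast hE.card_pos
  rw [pow_succ', ← mul_div_mul_left (exitCount T E n y : ℝ) _ hq.ne']
  gcongr
  exact_mod_cast exitCount_map_le n y

theorem IsDigitSystem.exists_add_mem_digitSums (h : IsDigitSystem T E Λ) {y : G}
    (hy : y ∈ almostStabilizer T E) : ∃ n, ∃ e ∈ digitSums T E n, e + y ∈ digitSums T E n := by
  obtain ⟨n, hn⟩ := (Tendsto.eventually hy (gt_mem_nhds one_pos)).exists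
  refine ⟨n, ?_⟩
  by_contra! hne
  have hq : (E.card : ℝ) ^ n ≠ 0 := by exact_mod_cast (pow_pos h.nonempty.card_pos n).ne'
  have hall : exitCount T E n y = E.card ^ n := by
    rw [exitCount, Finset.filter_true_of_mem hne, h.card_digitSums]
  rw [hall, Nat.cast_pow, div_self hq] at hn
  exact lt_irrefl _ hn

/-- The entry `#((T x + E) ∩ (y + E))` of the contact matrix. -/
def contactCount (T : G →+ G) (E : Finset G) (x y : G) : ℕ :=
  ((T x +ᵥ E) ∩ (y +ᵥ E)).card

variable {ι : Type*} [Fintype ι] {v : ι → G}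

theorem IsDigitSystem.exitCount_succ_le (h : IsDigitSystem T E Λ) {y : G} (hy : y ∈ Λ)
    (hv : ∀ x ∈ Λ, x ≠ 0 → ((T x +ᵥ E) ∩ (y +ᵥ E)).Nonempty → x ∈ Set.range v) (n : ℕ) :
    exitCount T E (n + 1) y ≤ ∑ i, contactCount T E (v i) y * exitCount T E n (v i) := by
  set S := fun n => digitSums T E n
  have hsub : (S (n + 1)).filter (fun e => e + y ∉ S (n + 1)) ⊆
      Finset.univ.biUnion fun i => Finset.image₂ (fun s e => s - y + T e)
        ((T (v i) +ᵥ E) ∩ (y +ᵥ E)) ((S n).filter fun e => e + v i ∉ S n) := by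
    intro z hz
    obtain ⟨hz, hzy⟩ := Finset.mem_filter.1 hz
    obtain ⟨d', hd', e, he, rfl⟩ := mem_digitSums_succ.1 hz
    obtain ⟨d, hd, x, hx, hdx⟩ := h.exists_digit y hy d' hd'
    have hex : e + x ∉ S n := fun hex =>
      hzy (mem_digitSums_succ.2 ⟨d, hd, e + x, hex, by
        rw [map_add, add_comm (T e), ← add_assoc, ← hdx]; abel⟩)
    have hcontact : y + d' ∈ (T x +ᵥ E) ∩ (y +ᵥ E) := Finset.mem_inter.2
      ⟨Finset.mem_vadd_finset.2 ⟨d, hd, by rw [hdx, add_comm]; rfl⟩,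
        Finset.vadd_mem_vadd_finset hd'⟩
    obtain ⟨i, rfl⟩ := hv x hx (by rintro rfl; exact hex (by rwa [add_zero])) ⟨_, hcontact⟩
    exact Finset.mem_biUnion.2 ⟨i, Finset.mem_univ i, Finset.mem_image₂.2
      ⟨y + d', hcontact, e, Finset.mem_filter.2 ⟨he, hex⟩, by abel⟩⟩
  exact (Finset.card_le_card hsub).trans (Finset.card_biUnion_le.trans
    (Finset.sum_le_sum fun i _ => Finset.card_image₂_le _ _ _))

theorem IsDigitSystem.sum_contactCount_le (h : IsDigitSystem T E Λ) (hv : Function.Injective v)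
    (hvΛ : ∀ i, v i ∈ Λ) (y : G) : ∑ i, contactCount T E (v i) y ≤ E.card := by
  unfold contactCount
  rw [← Finset.card_vadd_finset y E, ← Finset.card_biUnion]
  · exact Finset.card_le_card (Finset.biUnion_subset.2 fun i _ => Finset.inter_subset_right)
  · intro i _ j _ hne
    refine Finset.disjoint_left.2 fun s hs hs' => hne (hv ?_)
    obtain ⟨d, hd, rfl⟩ := Finset.mem_vadd_finset.1 (Finset.mem_inter.1 hs).1
    obtain ⟨d', hd', heq⟩ := Finset.mem_vadd_finset.1 (Finset.mem_inter.1 hs').1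
    refine (h.eq_and_eq_of_add_map_eq hd hd' (Λ.sub_mem (hvΛ i) (hvΛ j)) ?_).2
    simpa only [add_comm, vadd_eq_add] using heq.symm

end DigitSums

section NonnegativeMatrix

variable {ι : Type*} [Fintype ι] {C : Matrix ι ι ℝ} {q : ℝ}

theorem eq_zero_of_vecMul_eq_smul (hno : ∀ t : ι → ℝ, C.mulVec t = q • t → t = 0)
    {s : ι → ℝ} (hs : C.vecMul s = q • s) : s = 0 := by
  classical
  by_contra hs0
  have hdet : (C - q • (1 : Matrix ι ι ℝ)).det = 0 :=
    Matrix.exists_vecMul_eq_zero_iff.1 ⟨s, hs0, by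
      rw [Matrix.vecMul_sub, hs, Matrix.vecMul_smul, Matrix.vecMul_one, sub_self]⟩
  obtain ⟨t, ht0, ht⟩ := Matrix.exists_mulVec_eq_zero_iff.2 hdet
  rw [Matrix.sub_mulVec, Matrix.smul_mulVec, Matrix.one_mulVec, sub_eq_zero] at ht
  exact ht0 (hno t ht)

theorem monotone_inv_smul_vecMul (hC : ∀ x y, 0 ≤ C x y) (hq : 0 < q) :
    Monotone fun s : ι → ℝ => q⁻¹ • C.vecMul s := fun _ _ hst =>
  smul_le_smul_of_nonneg_left (fun y => Finset.sum_le_sum fun x _ =>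
    mul_le_mul_of_nonneg_right (hst x) (hC x y)) (inv_pos.2 hq).le

theorem inv_smul_one_vecMul_le (hq : 0 < q) (hsum : ∀ y, ∑ x, C x y ≤ q) :
    q⁻¹ • C.vecMul 1 ≤ 1 := fun y => by
  simpa [Matrix.vecMul, dotProduct, inv_mul_le_iff₀ hq] using hsum y

theorem tendsto_iterate_inv_smul_vecMul (hC : ∀ x y, 0 ≤ C x y) (hq : 0 < q)
    (hsum : ∀ y, ∑ x, C x y ≤ q) (hno : ∀ t : ι → ℝ, C.mulVec t = q • t → t = 0) :
    Tendsto (fun n => (fun s : ι → ℝ => q⁻¹ • C.vecMul s)^[n] 1) atTop (𝓝 0) := by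
  set f : (ι → ℝ) → ι → ℝ := fun s => q⁻¹ • C.vecMul s with hf
  have hmono : Monotone f := monotone_inv_smul_vecMul hC hq
  have hanti : Antitone fun n => f^[n] 1 :=
    hmono.antitone_iterate_of_map_le (inv_smul_one_vecMul_le hq hsum)
  have hnonneg (n : ℕ) : 0 ≤ f^[n] 1 :=
    hmono.seq_le_seq (x := fun _ => 0) n zero_le_one (fun _ _ => by simp [hf])
      fun k _ => (Function.iterate_succ_apply' f k 1).ge
  have hlim := tendsto_atTop_ciInf hanti ⟨0, Set.forall_mem_range.2 hnonneg⟩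
  have hfix : f (⨅ n, f^[n] 1) = ⨅ n, f^[n] 1 := isFixedPt_of_tendsto_iterate hlim
    (Continuous.continuousAt (by fun_prop))
  have hzero : ⨅ n, f^[n] 1 = 0 := eq_zero_of_vecMul_eq_smul hno (by
    conv_rhs => rw [← hfix, hf, smul_inv_smul₀ hq.ne'])
  rwa [hzero] at hlim

theorem tendsto_zero_of_le_inv_smul_vecMul (hC : ∀ x y, 0 ≤ C x y) (hq : 0 < q)
    (hsum : ∀ y, ∑ x, C x y ≤ q) (hno : ∀ t : ι → ℝ, C.mulVec t = q • t → t = 0)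
    {b : ℕ → ι → ℝ} (hb : ∀ n, 0 ≤ b n) (hb0 : b 0 ≤ 1)
    (hstep : ∀ n, b (n + 1) ≤ q⁻¹ • C.vecMul (b n)) : Tendsto b atTop (𝓝 0) := by
  refine tendsto_pi_nhds.2 fun y => squeeze_zero (fun n => hb n y) (fun n => ?_)
    (tendsto_pi_nhds.1 (tendsto_iterate_inv_smul_vecMul hC hq hsum hno) y)
  set f : (ι → ℝ) → ι → ℝ := fun s => q⁻¹ • C.vecMul s
  exact (monotone_inv_smul_vecMul hC hq).seq_le_seq (y := fun n => f^[n] 1) n hb0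
    (fun k _ => hstep k) (fun k _ => (Function.iterate_succ_apply' f k 1).ge) y

theorem mulVec_abs_eq_smul (hC : ∀ x y, 0 ≤ C x y) (hsum : ∀ y, ∑ x, C x y ≤ q)
    (hq : 0 ≤ q) {t : ι → ℝ} (ht : C.mulVec t = q • t) : C.mulVec |t| = q • |t| := by
  have hle (x : ι) : q * |t x| ≤ C.mulVec |t| x := by
    have : q * t x = ∑ y, C x y * t y := (congrFun ht x).symm
    rw [← abs_of_nonneg hq, ← abs_mul, this]
    refine (Finset.abs_sum_le_sum_abs _ _).trans_eq (Finset.sum_congr rfl fun y _ => ?_)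
    rw [abs_mul, abs_of_nonneg (hC x y), Pi.abs_apply]
  have hge : ∑ x, C.mulVec |t| x ≤ ∑ x, q * |t x| := by
    simp only [Matrix.mulVec, dotProduct]
    rw [Finset.sum_comm]
    refine Finset.sum_le_sum fun y _ => ?_
    rw [← Finset.sum_mul]
    exact mul_le_mul_of_nonneg_right (hsum y) (abs_nonneg _)
  have heq := (Finset.sum_eq_sum_iff_of_le fun x _ => hle x).1
    (le_antisymm (Finset.sum_le_sum fun x _ => hle x) hge)
  exact funext fun x => (heq x (Finset.mem_univ x)).symm

theorem exists_invariant_eigenvector (hC : ∀ x y, 0 ≤ C x y) (hsum : ∀ y, ∑ x, C x y ≤ q)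
    (hq : 0 ≤ q) {σ : ι → ι} (hσ : Function.Involutive σ)
    (hCσ : ∀ x y, C (σ x) (σ y) = C x y) {t : ι → ℝ} (ht : C.mulVec t = q • t) (ht0 : t ≠ 0) :
    ∃ s : ι → ℝ, s ≠ 0 ∧ (∀ x, s (σ x) = s x) ∧ C.mulVec s = q • s := by
  have habs : C.mulVec |t| = q • |t| := mulVec_abs_eq_smul hC hsum hq ht
  have habsσ : C.mulVec (|t| ∘ σ) = q • (|t| ∘ σ) := by
    funext x
    have h := congrFun habs (σ x)
    simp only [Matrix.mulVec, dotProduct] at h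
    rw [← Equiv.sum_comp hσ.toPerm] at h
    simp only [Function.Involutive.coe_toPerm, hCσ] at h
    exact h
  refine ⟨|t| + |t| ∘ σ, fun h0 => ht0 (funext fun x => ?_), fun x => ?_, ?_⟩
  · have h : |t x| + |t (σ x)| = 0 := congrFun h0 x
    exact abs_eq_zero.1 (by linarith [abs_nonneg (t x), abs_nonneg (t (σ x))])
  · simp only [Pi.add_apply, Function.comp_apply, hσ x, add_comm]
  · rw [Matrix.mulVec_add, habs, habsσ, smul_add]

end NonnegativeMatrix

section ContactMatrix

variable {G ι : Type*} [AddCommGroup G] [DecidableEq G] [Fintype ι] {T : G →+ G} {E : Finset G}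
  {Λ : AddSubgroup G} {v : ι → G}

theorem IsDigitSystem.mem_almostStabilizer (h : IsDigitSystem T E Λ) (hv : Function.Injective v)
    (hvΛ : ∀ i, v i ∈ Λ)
    (hclosed : ∀ i, ∀ x ∈ Λ, x ≠ 0 → ((T x +ᵥ E) ∩ (v i +ᵥ E)).Nonempty → x ∈ Set.range v)
    (hno : ∀ t : ι → ℝ, (Matrix.of fun i j => (contactCount T E (v i) (v j) : ℝ)).mulVec t =
      (E.card : ℝ) • t → t = 0) (i : ι) : v i ∈ almostStabilizer T E := by
  have hq : (0 : ℝ) < E.card := by exact_mod_cast h.nonempty.card_pos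
  refine tendsto_pi_nhds.1 (tendsto_zero_of_le_inv_smul_vecMul
    (b := fun n i => (exitCount T E n (v i) : ℝ) / (E.card : ℝ) ^ n) (fun i j => Nat.cast_nonneg _)
    hq (fun j => ?_) hno (fun n i => by positivity) (fun i => ?_) (fun n j => ?_)) i
  · exact_mod_cast h.sum_contactCount_le hv hvΛ (v j)
  · have hle : exitCount T E 0 (v i) ≤ 1 := Finset.card_filter_le _ _
    simpa using hle
  · have hle : (exitCount T E (n + 1) (v j) : ℝ) ≤
        ∑ i, (contactCount T E (v i) (v j) : ℝ) * exitCount T E n (v i) := by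
      exact_mod_cast h.exitCount_succ_le (hvΛ j) (hclosed j) n
    simp only [Pi.smul_apply, Matrix.vecMul, dotProduct, smul_eq_mul]
    calc (exitCount T E (n + 1) (v j) : ℝ) / (E.card : ℝ) ^ (n + 1)
        ≤ (∑ i, (contactCount T E (v i) (v j) : ℝ) * exitCount T E n (v i)) /
          (E.card : ℝ) ^ (n + 1) := by gcongr
      _ = (E.card : ℝ)⁻¹ * ∑ i, exitCount T E n (v i) / (E.card : ℝ) ^ n *
          contactCount T E (v i) (v j) := by
        rw [Finset.sum_div, Finset.mul_sum]
        exact Finset.sum_congr rfl fun i _ => by field_simp; ring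

end ContactMatrix

theorem measure_inter_eq_zero_of_sum_measure_le {Ω ι : Type*} [MeasurableSpace Ω] {μ : Measure Ω}
    {A : ι → Set Ω} {S : Finset ι} (hfin : ∀ i ∈ S, μ (A i) ≠ ⊤)
    (hS : ∑ i ∈ S, μ (A i) ≤ μ (⋃ i ∈ S, A i)) {a b : ι} (ha : a ∈ S) (hb : b ∈ S) (hab : a ≠ b)
    (hAb : MeasurableSet (A b)) : μ (A a ∩ A b) = 0 := by
  classical
  have hb' : b ∈ S.erase a := Finset.mem_erase.2 ⟨hab.symm, hb⟩
  set R := (S.erase a).erase b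
  have hle : μ (⋃ i ∈ S, A i) ≤ μ (A a ∪ A b) + ∑ i ∈ R, μ (A i) := by
    rw [← Finset.insert_erase ha, ← Finset.insert_erase hb', Finset.set_biUnion_insert,
      Finset.set_biUnion_insert, ← Set.union_assoc]
    exact (measure_union_le _ _).trans (by gcongr; exact measure_biUnion_finset_le _ _)
  have hsum : ∑ i ∈ S, μ (A i) = μ (A a ∪ A b) + ∑ i ∈ R, μ (A i) + μ (A a ∩ A b) := by
    rw [← Finset.add_sum_erase S _ ha, ← Finset.add_sum_erase _ _ hb', ← add_assoc,
      ← measure_union_add_inter (A a) hAb, add_right_comm]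
  have hunion : μ (A a ∪ A b) + ∑ i ∈ R, μ (A i) ≠ ⊤ :=
    ne_top_of_le_ne_top (ENNReal.sum_ne_top.2 hfin) (hsum ▸ le_self_add)
  refine nonpos_iff_eq_zero.1 ((ENNReal.add_le_add_iff_left hunion).1 ?_)
  rw [← hsum, add_zero]
  exact hS.trans hle

section LatticeTilings

variable {X : Type*} [NormedAddCommGroup X]

/-- Only finitely many points of `S` lie in any given ball. -/
def IsBoundedlyFinite (S : Set X) : Prop := ∀ B : ℝ, {x ∈ S | ‖x‖ ≤ B}.Finite

namespace IsBoundedlyFinite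

variable {S : Set X}

theorem mono {S' : Set X} (h : IsBoundedlyFinite S) (hs : S' ⊆ S) : IsBoundedlyFinite S' :=
  fun B => (h B).subset fun _ hx => ⟨hs hx.1, hx.2⟩

theorem countable (h : IsBoundedlyFinite S) : S.Countable := by
  have hS : S ⊆ ⋃ n : ℕ, {x ∈ S | ‖x‖ ≤ n} := fun x hx =>
    let ⟨n, hn⟩ := exists_nat_ge ‖x‖
    Set.mem_iUnion.2 ⟨n, hx, hn⟩
  exact (Set.countable_iUnion fun n : ℕ => (h n).countable).mono hS

theorem isClosed (h : IsBoundedlyFinite S) : IsClosed S := by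
  refine isClosed_of_closure_subset fun z hz => ?_
  have hfin : (Metric.ball z 1 ∩ S).Finite := by
    refine (h (‖z‖ + 1)).subset fun x hx => ⟨hx.2, ?_⟩
    have := norm_le_norm_add_norm_sub z x
    have : ‖x - z‖ < 1 := mem_ball_iff_norm.1 hx.1
    rw [norm_sub_rev] at this
    linarith
  have hmem : z ∈ closure (Metric.ball z 1 ∩ S) :=
    Metric.isOpen_ball.inter_closure ⟨Metric.mem_ball_self one_pos, hz⟩
  exact (hfin.isClosed.closure_eq ▸ hmem).2

theorem isClosed_add (h : IsBoundedlyFinite S) {D : Set X} (hD : IsCompact D) :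
    IsClosed (S + D) :=
  h.isClosed.add_right_of_isCompact hD

theorem vadd_ne_self [IsAddTorsionFree X] {Λ : AddSubgroup X} (hΛ : IsBoundedlyFinite (Λ : Set X))
    {D : Set X} (hD : IsCompact D) (hD0 : D.Nonempty) {x : X} (hx : x ∈ Λ) (hx0 : x ≠ 0) :
    x +ᵥ D ≠ D := by
  intro heq
  obtain ⟨M, hM⟩ := hD.isBounded.exists_norm_le
  obtain ⟨δ, hδ⟩ := hD0
  have horbit (n : ℕ) : n • x + δ ∈ D := by
    induction n with
    | zero => simpa using hδ
    | succ n ih =>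
      rw [succ_nsmul', add_assoc, ← heq]
      exact Set.vadd_mem_vadd_set ih
  refine Set.infinite_range_of_injective (injective_nsmul_iff_not_isOfFinAddOrder.2
    (not_isOfFinAddOrder_of_isAddTorsionFree hx0)) ((hΛ (M + M)).subset ?_)
  rintro _ ⟨n, rfl⟩
  refine ⟨Λ.nsmul_mem hx n, ?_⟩
  simpa using (norm_sub_le (n • x + δ) δ).trans (add_le_add (hM _ (horbit n)) (hM _ hδ))

end IsBoundedlyFinite

section Neighbors

variable {Λ H : AddSubgroup X} {D : Set X}

theorem mem_of_add_mem_add (hHΛ : H ≤ Λ) (hnb : ∀ x ∈ Λ, (D ∩ (x +ᵥ D)).Nonempty → x ∈ H) {x δ : X}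
    (hx : x ∈ Λ) (hδ : δ ∈ D) (h : x + δ ∈ (H : Set X) + D) : x ∈ H := by
  obtain ⟨y, hy, δ', hδ', heq⟩ := Set.mem_add.1 h
  have hxy : x - y ∈ H := hnb _ (Λ.sub_mem hx (hHΛ hy)) ⟨δ', hδ', δ, hδ, by
    change x - y + δ = δ'
    rw [sub_add_eq_add_sub, ← heq, add_sub_cancel_left]⟩
  simpa using H.add_mem hxy hy

theorem isClopen_add (hΛ : IsBoundedlyFinite (Λ : Set X)) (hHΛ : H ≤ Λ) (hD : IsCompact D)
    (hcov : (Λ : Set X) + D = Set.univ) (hnb : ∀ x ∈ Λ, (D ∩ (x +ᵥ D)).Nonempty → x ∈ H) :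
    IsClopen ((H : Set X) + D) := by
  have hcompl : ((H : Set X) + D)ᶜ = (Λ \ H : Set X) + D := by
    ext z
    constructor
    · intro hz
      obtain ⟨x, hx, δ, hδ, rfl⟩ : z ∈ (Λ : Set X) + D := hcov ▸ Set.mem_univ z
      exact Set.add_mem_add ⟨hx, fun hxH => hz (Set.add_mem_add hxH hδ)⟩ hδ
    · rintro ⟨x, ⟨hx, hxH⟩, δ, hδ, rfl⟩ hz
      exact hxH (mem_of_add_mem_add hHΛ hnb hx hδ hz)
  refine ⟨(hΛ.mono hHΛ).isClosed_add hD, isClosed_compl_iff.1 ?_⟩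
  rw [hcompl]
  exact (hΛ.mono Set.sdiff_subset).isClosed_add hD

end Neighbors

/-- `F` is a non-empty compact solution of the set equation `T F = E + F`: the self-affine tile with
digit set `E`. -/
structure IsSelfAffine (T : X →+ X) (E : Finset X) (F : Set X) : Prop where
  nonempty : F.Nonempty
  isCompact : IsCompact F
  image_eq : T '' F = E + F

variable {E : Finset X} {Λ : AddSubgroup X} {D F : Set X}

theorem IsSelfAffine.image_iterate [DecidableEq X] {T : X →+ X} (h : IsSelfAffine T E F) (n : ℕ) :
    T^[n] '' F = digitSums T E n + F := by
  induction n with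
  | zero => simp [digitSums]
  | succ n ih =>
    rw [Function.iterate_succ', Set.image_comp, ih, Set.image_add, h.image_eq, digitSums,
      Finset.coe_add, Finset.coe_image, ← add_assoc, add_comm (T '' _)]

theorem IsSelfAffine.exists_norm_sub_le {T : X →+ X} {ρ : ℝ} (hρ : 0 < ρ)
    (hT : ∀ x, ρ * ‖x‖ ≤ ‖T x‖) (h : IsSelfAffine T E F) (hE : IsDigitSystem T E Λ) {M : ℝ}
    (hM : ∀ z, ∃ y ∈ (Λ : Set X) + F, ‖z - y‖ ≤ M) (n : ℕ) (z : X) :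
    ∃ y ∈ (Λ : Set X) + F, ‖z - y‖ ≤ M / ρ ^ n := by
  induction n generalizing z with
  | zero => simpa using hM z
  | succ n ih =>
    obtain ⟨d₀, hd₀⟩ := hE.nonempty
    obtain ⟨_, ⟨x, hx, f, hf, rfl⟩, hle⟩ := ih (T z - d₀)
    obtain ⟨d, hd, y, hy, hxy⟩ := hE.exists_digit x hx d₀ hd₀
    obtain ⟨f', hf', hdf⟩ : d + f ∈ T '' F := h.image_eq ▸ Set.add_mem_add hd hf
    refine ⟨y + f', Set.add_mem_add hy hf', ?_⟩
    have hTz : T (z - (y + f')) = T z - d₀ - (x + f) := by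
      rw [map_sub, map_add, hdf, sub_sub, ← add_assoc d₀, add_comm d₀, hxy]
      abel
    rw [pow_succ, ← div_div, le_div_iff₀' hρ]
    exact (hT _).trans (hTz ▸ hle)

theorem IsSelfAffine.add_eq_univ {T : X →+ X} {ρ : ℝ} (hρ : 1 < ρ) (hT : ∀ x, ρ * ‖x‖ ≤ ‖T x‖)
    (h : IsSelfAffine T E F) (hE : IsDigitSystem T E Λ) (hΛ : IsBoundedlyFinite (Λ : Set X))
    (hD : IsCompact D) (hcov : (Λ : Set X) + D = Set.univ) : (Λ : Set X) + F = Set.univ := by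
  obtain ⟨f₀, hf₀⟩ := h.nonempty
  obtain ⟨M, hM⟩ := hD.isBounded.exists_norm_le
  have hbdd (z : X) : ∃ y ∈ (Λ : Set X) + F, ‖z - y‖ ≤ M + ‖f₀‖ := by
    obtain ⟨x, hx, δ, hδ, rfl⟩ : z ∈ (Λ : Set X) + D := hcov ▸ Set.mem_univ z
    refine ⟨x + f₀, Set.add_mem_add hx hf₀, ?_⟩
    simpa only [add_sub_add_left_eq_sub] using
      (norm_sub_le δ f₀).trans (add_le_add_left (hM δ hδ) ‖f₀‖)
  refine Set.eq_univ_of_forall fun z => (hΛ.isClosed_add h.isCompact).closure_subset ?_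
  refine Metric.mem_closure_iff.2 fun ε hε => ?_
  have hlim : Tendsto (fun n : ℕ => (M + ‖f₀‖) / ρ ^ n) atTop (𝓝 0) :=
    (tendsto_pow_atTop_atTop_of_one_lt hρ).const_div_atTop _
  obtain ⟨n, hn⟩ := (hlim.eventually (gt_mem_nhds hε)).exists
  obtain ⟨y, hy, hle⟩ := h.exists_norm_sub_le (one_pos.trans hρ) hT hE hbdd n z
  exact ⟨y, hy, by rw [dist_eq_norm]; exact hle.trans_lt hn⟩

variable [MeasurableSpace X] {μ : Measure X}

theorem add_eq_univ_of_isAddFundamentalDomain [μ.IsOpenPosMeasure]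
    (hΛ : IsBoundedlyFinite (Λ : Set X)) (hD : IsCompact D) (h : IsAddFundamentalDomain Λ D μ) :
    (Λ : Set X) + D = Set.univ := by
  have hae : ∀ᵐ z ∂μ, z ∈ (Λ : Set X) + D := by
    filter_upwards [h.ae_covers] with z ⟨x, hx⟩
    exact ⟨-x, Λ.neg_mem x.2, x +ᵥ z, hx, neg_add_cancel_left (x : X) z⟩
  exact Set.compl_empty_iff.1
    ((hΛ.isClosed_add hD).isOpen_compl.eq_empty_of_measure_zero (μ := μ) hae)

theorem isTiling_of_isAddFundamentalDomain [μ.IsOpenPosMeasure]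
    (hΛ : IsBoundedlyFinite (Λ : Set X)) (hD : IsCompact D) (h : IsAddFundamentalDomain Λ D μ) :
    IsTiling μ ((· +ᵥ D) '' (Λ : Set X)) := by
  have : Countable Λ := hΛ.countable.to_subtype
  refine ⟨one_pos, Set.forall_mem_image.2 fun x _ => hD.vadd x, ?_⟩
  have hdisj : ∀ᵐ z ∂μ, ∀ x y : Λ, x ≠ y → z ∉ (x +ᵥ D) ∩ (y +ᵥ D) := by
    refine ae_all_iff.2 fun x => ae_all_iff.2 fun y =>
      eventually_imp_distrib_left.2 fun hne => ?_
    exact measure_eq_zero_iff_ae_notMem.1 (h.aedisjoint hne)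
  filter_upwards [hdisj] with z hz
  obtain ⟨x, hx, δ, hδ, rfl⟩ : z ∈ (Λ : Set X) + D :=
    add_eq_univ_of_isAddFundamentalDomain hΛ hD h ▸ Set.mem_univ z
  refine Set.encard_eq_one.2 ⟨x +ᵥ D, Set.eq_singleton_iff_unique_mem.2
    ⟨⟨⟨x, hx, rfl⟩, Set.vadd_mem_vadd_set hδ⟩, ?_⟩⟩
  rintro _ ⟨⟨y, hy, rfl⟩, hzy⟩
  by_contra hne
  exact hz ⟨y, hy⟩ ⟨x, hx⟩ (fun hyx => hne (by rw [Subtype.mk.inj hyx]))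
    ⟨hzy, Set.vadd_mem_vadd_set hδ⟩

theorem measure_ne_zero_of_add_eq_univ [μ.IsAddLeftInvariant] [NeZero μ] {S : Set X}
    (hS : S.Countable) (h : S + D = Set.univ) : μ D ≠ 0 := by
  intro h0
  refine NeZero.ne μ (Measure.measure_univ_eq_zero.1 ?_)
  rw [← h, ← Set.iUnion_add_left_image]
  refine (measure_biUnion_null_iff hS).2 fun x _ => ?_
  rw [← h0, ← measure_vadd μ x D]
  rfl

variable [BorelSpace X] [μ.IsAddHaarMeasure]

theorem isAddFundamentalDomain_of_isTiling [IsAddTorsionFree X] (hΛ : IsBoundedlyFinite (Λ : Set X))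
    (hD : IsCompact D) (h : IsTiling μ ((· +ᵥ D) '' (Λ : Set X))) :
    IsAddFundamentalDomain Λ D μ := by
  have hcov : ∀ᵐ z ∂μ, ∃ x : Λ, x +ᵥ z ∈ D := by
    filter_upwards [h.2.2] with z hz
    obtain ⟨_, ⟨x, hx, rfl⟩, hzx⟩ := Set.nonempty_of_encard_ne_zero
      (hz.trans_ne one_ne_zero)
    exact ⟨-⟨x, hx⟩, Set.mem_vadd_set_iff_neg_vadd_mem.1 hzx⟩
  refine .mk'' hD.isClosed.measurableSet.nullMeasurableSet hcov (fun x hx0 => ?_)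
    fun x => (measurePreserving_vadd x μ).quasiMeasurePreserving
  have hnot : ∀ᵐ z ∂μ, z ∉ (x +ᵥ D) ∩ D := by
    filter_upwards [h.2.2] with z hz hzD
    refine hΛ.vadd_ne_self hD ⟨z, hzD.2⟩ x.2 (by simpa using hx0) ?_
    exact Set.encard_le_one_iff.1 hz.le _ _ ⟨⟨x, x.2, rfl⟩, hzD.1⟩
      ⟨⟨0, Λ.zero_mem, zero_vadd X D⟩, hzD.2⟩
  simpa [AEDisjoint, ae_iff] using hnot

section Expansion

variable [LocallyCompactSpace X] {T : X ≃ₜ+ X}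

theorem measure_image_eq_addEquivAddHaarChar_mul [μ.Regular] (T : X ≃ₜ+ X) (S : Set X) :
    μ (T '' S) = addEquivAddHaarChar T * μ S := by
  have h := addEquivAddHaarChar_smul_preimage μ (X := T '' S) T
  rw [Set.preimage_image_eq S T.injective] at h
  exact h.symm

theorem isAddFundamentalDomain_map [μ.Regular] (h : IsAddFundamentalDomain Λ D μ) :
    IsAddFundamentalDomain (Λ.map (T : X →+ X)) (T '' D) μ := by
  have hqmp : Measure.QuasiMeasurePreserving T.symm μ μ := by
    have hmeas : Measurable T.symm := T.symm.continuous.measurable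
    refine ⟨hmeas, .mk fun S hS hS0 => ?_⟩
    have himage : T.symm ⁻¹' S = T '' S := (T.toEquiv.image_eq_preimage_symm S).symm
    rw [Measure.map_apply hmeas hS, himage, measure_image_eq_addEquivAddHaarChar_mul, hS0, mul_zero]
  let e := Λ.equivMapOfInjective (T : X →+ X) T.injective
  refine h.image_of_equiv T.toEquiv hqmp e.symm fun g z => ?_
  obtain ⟨x, rfl⟩ := e.surjective g
  change T (e.symm (e x) +ᵥ z) = (e x : X) + T z
  rw [e.symm_apply_apply]
  exact map_add T (x : X) z

theorem card_mul_measure_le_measure_image [μ.Regular] (hΛ : IsBoundedlyFinite (Λ : Set X))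
    (hD : IsCompact D) (h : IsAddFundamentalDomain Λ D μ) (hTΛ : ∀ x ∈ Λ, T x ∈ Λ) {S : Finset X}
    (hS : ∀ s ∈ S, s ∈ Λ) (hincong : ∀ s ∈ S, ∀ s' ∈ S, ∀ y ∈ Λ, s - s' = T y → s = s') :
    S.card * μ D ≤ μ (T '' D) := by
  have : Countable (Λ.map (T : X →+ X)) := (hΛ.countable.image T).to_subtype
  have hdisj {x y : X} (hx : x ∈ Λ) (hy : y ∈ Λ) (hne : x ≠ y) : AEDisjoint μ (x +ᵥ D) (y +ᵥ D) :=
    h.aedisjoint (i := ⟨x, hx⟩) (j := ⟨y, hy⟩) (by simpa using hne)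
  have hnull (x : X) : NullMeasurableSet (x +ᵥ D) μ :=
    (hD.vadd x).isClosed.measurableSet.nullMeasurableSet
  have hunion : μ (⋃ s : S, (s : X) +ᵥ D) = S.card * μ D := by
    rw [measure_iUnion₀ (fun (s s' : S) hne =>
      hdisj (hS _ s.2) (hS _ s'.2) (Subtype.coe_ne_coe.2 hne)) fun s => hnull _]
    simp
  rw [← hunion]
  refine (isAddFundamentalDomain_map h).measure_le_of_pairwise_disjoint
    (.iUnion fun s : S => hnull _) ?_
  rintro ⟨_, x, hx, rfl⟩ ⟨_, y, hy, rfl⟩ hne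
  refine AEDisjoint.mono ?_ Set.inter_subset_left Set.inter_subset_left
  change AEDisjoint μ (T x +ᵥ ⋃ s : S, (s : X) +ᵥ D) (T y +ᵥ ⋃ s : S, (s : X) +ᵥ D)
  simp only [Set.vadd_set_iUnion, vadd_vadd, AEDisjoint.iUnion_left_iff,
    AEDisjoint.iUnion_right_iff]
  intro s' s
  refine hdisj (Λ.add_mem (hTΛ x hx) (hS _ s.2)) (Λ.add_mem (hTΛ y hy) (hS _ s'.2)) fun heq => ?_
  have hss : (s : X) = s' := hincong _ s.2 _ s'.2 (y - x) (Λ.sub_mem hy hx)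
    (by rw [map_sub, sub_eq_sub_iff_add_eq_add, add_comm, heq])
  rw [hss] at heq
  exact hne (Subtype.ext (add_right_cancel heq))

theorem card_le_addEquivAddHaarChar [μ.Regular] (hΛ : IsBoundedlyFinite (Λ : Set X))
    (hD : IsCompact D) (h : IsAddFundamentalDomain Λ D μ) (hTΛ : ∀ x ∈ Λ, T x ∈ Λ) {S : Finset X}
    (hS : ∀ s ∈ S, s ∈ Λ) (hincong : ∀ s ∈ S, ∀ s' ∈ S, ∀ y ∈ Λ, s - s' = T y → s = s') :
    S.card ≤ addEquivAddHaarChar T := by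
  have : Countable Λ := hΛ.countable.to_subtype
  have hle := card_mul_measure_le_measure_image hΛ hD h hTΛ hS hincong
  rw [measure_image_eq_addEquivAddHaarChar_mul,
    ENNReal.mul_le_mul_iff_left (h.measure_ne_zero (NeZero.ne μ)) hD.measure_lt_top.ne] at hle
  exact_mod_cast hle

theorem IsDigitSystem.card_le_addEquivAddHaarChar [μ.Regular] (hE : IsDigitSystem (T : X →+ X) E Λ)
    (hΛ : IsBoundedlyFinite (Λ : Set X)) (hD : IsCompact D) (h : IsAddFundamentalDomain Λ D μ) :
    E.card ≤ addEquivAddHaarChar T := by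
  classical
  obtain ⟨d₀, hd₀⟩ := hE.nonempty
  rw [← Finset.card_image_of_injective E (sub_left_injective (b := d₀))]
  refine SelfAffine.card_le_addEquivAddHaarChar hΛ hD h hE.map_mem ?_ ?_
  · exact Finset.forall_mem_image.2 fun d hd => hE.sub_mem d hd d₀ hd₀
  · simp only [Finset.forall_mem_image, sub_sub_sub_cancel_right]
    exact fun d hd d' hd' y hy heq => by rw [hE.digit_unique d hd d' hd' y hy heq]

theorem addEquivAddHaarChar_le_card (hΛ : IsBoundedlyFinite (Λ : Set X))
    (hF : IsSelfAffine (T : X →+ X) E F) (hcov : (Λ : Set X) + F = Set.univ) :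
    addEquivAddHaarChar T ≤ E.card := by
  let ν : Measure X := Measure.addHaar
  have hle : addEquivAddHaarChar T * ν F ≤ E.card * ν F := calc
    _ = ν (T '' F) := (measure_image_eq_addEquivAddHaarChar_mul T F).symm
    _ = ν (⋃ d ∈ E, d +ᵥ F) := by
      congr 1
      exact hF.image_eq.trans Set.iUnion_add_left_image.symm
    _ ≤ ∑ d ∈ E, ν (d +ᵥ F) := measure_biUnion_finset_le _ _
    _ = E.card * ν F := by simp
  rw [ENNReal.mul_le_mul_iff_left (measure_ne_zero_of_add_eq_univ hΛ.countable hcov)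
    hF.isCompact.measure_lt_top.ne] at hle
  exact_mod_cast hle

theorem isDigitSystem_of_addEquivAddHaarChar_le_card [μ.Regular]
    (hΛ : IsBoundedlyFinite (Λ : Set X)) (hD : IsCompact D) (h : IsAddFundamentalDomain Λ D μ)
    (hTΛ : ∀ x ∈ Λ, T x ∈ Λ) (hE : E.Nonempty) (hEsub : ∀ d ∈ E, ∀ d' ∈ E, d - d' ∈ Λ)
    (hEuniq : ∀ d ∈ E, ∀ d' ∈ E, ∀ y ∈ Λ, d - d' = T y → d = d')
    (hle : addEquivAddHaarChar T ≤ E.card) : IsDigitSystem (T : X →+ X) E Λ := by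
  classical
  refine ⟨T.injective, hE, hTΛ, hEsub, fun x hx d' hd' => ?_, hEuniq⟩
  by_contra! hno
  have hnot (d : X) (hd : d ∈ E) (y : X) (hy : y ∈ Λ) : x - (d - d') ≠ T y := fun heq =>
    hno d hd y hy (by rw [sub_eq_iff_eq_add'.1 heq, add_right_comm, sub_add_cancel]; rfl)
  have hxE : x ∉ E.image (· - d') := by
    intro hxE
    obtain ⟨d, hd, rfl⟩ := Finset.mem_image.1 hxE
    exact hnot d hd 0 Λ.zero_mem (by simp)
  have hcard : ((insert x (E.image (· - d'))).card : NNReal) ≤ addEquivAddHaarChar T := by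
    refine card_le_addEquivAddHaarChar hΛ hD h hTΛ ?_ ?_
    · simpa [hx] using fun d hd => hEsub d hd d' hd'
    · simp only [Finset.forall_mem_insert, Finset.forall_mem_image, implies_true, true_and]
      refine ⟨fun d hd y hy heq => absurd heq (hnot d hd y hy), fun d hd =>
        ⟨fun y hy heq => absurd ?_ (hnot d hd (-y) (Λ.neg_mem hy)), fun d₁ hd₁ y hy heq => ?_⟩⟩
      · rw [map_neg, ← heq, neg_sub]
      · rw [hEuniq d hd d₁ hd₁ y hy (by rw [← heq, sub_sub_sub_cancel_right])]
  rw [Finset.card_insert_of_notMem hxE,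
    Finset.card_image_of_injective _ sub_left_injective] at hcard
  exact (Nat.lt_succ_self E.card).not_ge (by exact_mod_cast hcard.trans hle)

theorem measure_image_iterate [μ.Regular] (T : X ≃ₜ+ X) (S : Set X) (n : ℕ) :
    μ (T^[n] '' S) = (addEquivAddHaarChar T : ENNReal) ^ n * μ S := by
  induction n with
  | zero => simp
  | succ n ih =>
    rw [Function.iterate_succ', Set.image_comp, measure_image_eq_addEquivAddHaarChar_mul, ih,
      pow_succ', mul_assoc]

theorem measure_vadd_inter_eq_zero [DecidableEq X] [μ.Regular] (hF : IsSelfAffine (T : X →+ X) E F)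
    (hE : IsDigitSystem (T : X →+ X) E Λ) (hT : E.card ≤ addEquivAddHaarChar T)
    {y : X} (hy : y ∈ almostStabilizer (T : X →+ X) E) (hy0 : y ≠ 0) : μ ((y +ᵥ F) ∩ F) = 0 := by
  obtain ⟨n, e, he, hey⟩ := hE.exists_add_mem_digitSums hy
  have hunion : ⋃ e ∈ digitSums (T : X →+ X) E n, e +ᵥ F = T^[n] '' F :=
    Set.iUnion_add_left_image.trans (hF.image_iterate n).symm
  have hsum : ∑ e ∈ digitSums (T : X →+ X) E n, μ (e +ᵥ F) ≤
      μ (⋃ e ∈ digitSums (T : X →+ X) E n, e +ᵥ F) := by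
    simp only [measure_vadd, Finset.sum_const, nsmul_eq_mul, hE.card_digitSums, Nat.cast_pow]
    rw [hunion, measure_image_iterate]
    gcongr
    exact_mod_cast hT
  have hnull : μ (((e + y) +ᵥ F) ∩ (e +ᵥ F)) = 0 :=
    measure_inter_eq_zero_of_sum_measure_le (A := fun d => d +ᵥ F)
      (fun d _ => (hF.isCompact.vadd d).measure_lt_top.ne) hsum hey he (by simpa using hy0)
      (hF.isCompact.vadd e).isClosed.measurableSet
  rwa [← vadd_vadd, ← Set.vadd_set_inter, measure_vadd] at hnull

theorem isAddFundamentalDomain_of_le_almostStabilizer [DecidableEq X] [μ.Regular]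
    (hF : IsSelfAffine (T : X →+ X) E F) (hE : IsDigitSystem (T : X →+ X) E Λ)
    (hT : E.card ≤ addEquivAddHaarChar T) (hcov : (Λ : Set X) + F = Set.univ)
    (hstab : Λ ≤ almostStabilizer (T : X →+ X) E) : IsAddFundamentalDomain Λ F μ := by
  refine .mk'' hF.isCompact.isClosed.measurableSet.nullMeasurableSet (.of_forall fun z => ?_)
    (fun y hy0 => ?_) fun y => (measurePreserving_vadd y μ).quasiMeasurePreserving
  · obtain ⟨x, hx, f, hf, rfl⟩ : z ∈ (Λ : Set X) + F := hcov ▸ Set.mem_univ z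
    exact ⟨-⟨x, hx⟩, by simpa [AddSubgroup.vadd_def] using hf⟩
  · exact measure_vadd_inter_eq_zero hF hE hT (hstab y.2) (by simpa using hy0)

end Expansion

end LatticeTilings

theorem mem_of_isClopen_of_snd_eq {X Y : Type*} [TopologicalSpace X] [TopologicalSpace Y]
    [PreconnectedSpace X] {U : Set (X × Y)} (hU : IsClopen U) {u z : X × Y} (hu : u ∈ U)
    (hz : z.2 = u.2) : z ∈ U := by
  have huniv : (fun x : X => (x, u.2)) ⁻¹' U = Set.univ :=
    (hU.preimage (by fun_prop)).eq_univ ⟨u.1, hu⟩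
  have hmem : z.1 ∈ (fun x : X => (x, u.2)) ⁻¹' U := huniv ▸ Set.mem_univ z.1
  rwa [Set.mem_preimage, ← hz] at hmem

theorem mul_norm_le_norm_pi_mul {ι : Type*} [Fintype ι] {R : ι → Type*}
    [∀ i, NormedDivisionRing (R i)] {ρ : ℝ} (hρ : 0 < ρ) {a : ∀ i, R i} (ha : ∀ i, ρ ≤ ‖a i‖)
    (z : ∀ i, R i) : ρ * ‖z‖ ≤ ‖a * z‖ := by
  rw [← le_div_iff₀' hρ]
  refine (pi_norm_le_iff_of_nonneg (by positivity)).2 fun i => ?_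
  rw [le_div_iff₀' hρ]
  calc ρ * ‖z i‖ ≤ ‖a i‖ * ‖z i‖ := by gcongr; exact ha i
    _ = ‖(a * z) i‖ := (norm_mul _ _).symm
    _ ≤ ‖a * z‖ := norm_le_pi_norm _ i

section RepresentationSpaceGeometry

open scoped Classical

variable {K : Type*} [Field K] [NumberField K]

instance secondCountableTopology_completion (v : HeightOneSpectrum (𝓞 K)) :
    SecondCountableTopology (v.adicCompletion K) := by
  have : Countable K := (Module.finBasis ℚ K).equivFun.toEquiv.countable_iff.2 inferInstance
  have : TopologicalSpace.SeparableSpace (v.adicCompletion K) :=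
    ⟨_, Set.countable_range (algebraMap K (v.adicCompletion K)), v.denseRange_algebraMap K⟩
  exact UniformSpace.secondCountable_of_separable _

instance locallyCompactSpace_completion (v : HeightOneSpectrum (𝓞 K)) :
    LocallyCompactSpace (v.adicCompletion K) :=
  (integersCompacts v).locallyCompactSpace_of_addGroup

instance isAddHaarMeasure_haarCompletion (v : HeightOneSpectrum (𝓞 K)) :
    (haarCompletion v).IsAddHaarMeasure :=
  Measure.isAddHaarMeasure_addHaarMeasure _

instance isAddHaarMeasure_repMeasure (α : K) : (repMeasure α).IsAddHaarMeasure := by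
  have : (Measure.pi fun v : DenomPrime α => haarCompletion v.1).IsAddHaarMeasure :=
    Measure.pi.isAddHaarMeasure _
  exact Measure.prod.instIsAddHaarMeasure _ _

instance regular_repMeasure (α : K) : (repMeasure α).Regular := by
  have : SigmaCompactSpace (RepSpace α) := inferInstance
  infer_instance

theorem normAtPlace_le_norm (w : InfinitePlace K) (z : mixedSpace K) : normAtPlace w z ≤ ‖z‖ := by
  rw [norm_eq_sup'_normAtPlace]
  exact Finset.le_sup' (fun w => normAtPlace w z) (Finset.mem_univ w)

theorem mul_norm_le_norm_mixedEmbedding_mul {ρ : ℝ} {ξ : K} (h : ∀ w : InfinitePlace K, ρ ≤ w ξ)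
    (z : mixedSpace K) : ρ * ‖z‖ ≤ ‖mixedEmbedding K ξ * z‖ := by
  obtain ⟨w, -, hw⟩ := Finset.exists_mem_eq_sup' Finset.univ_nonempty fun w => normAtPlace w z
  rw [norm_eq_sup'_normAtPlace, hw]
  calc ρ * normAtPlace w z ≤ w ξ * normAtPlace w z :=
        mul_le_mul_of_nonneg_right (h w) (normAtPlace_nonneg w z)
    _ = normAtPlace w (mixedEmbedding K ξ * z) := by rw [map_mul, normAtPlace_apply]
    _ ≤ ‖mixedEmbedding K ξ * z‖ := normAtPlace_le_norm w _

theorem one_lt_norm_algebraMap_completion {v : HeightOneSpectrum (𝓞 K)} {x : K} :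
    1 < ‖algebraMap K (v.adicCompletion K) x‖ ↔ 1 < v.valuation K x := by
  rw [← not_le, norm_le_one_iff, not_le,
    ← HeightOneSpectrum.valuedAdicCompletion_eq_valuation' v x]
  rfl

theorem exists_expansion {α : K} (hα : ∀ w : InfinitePlace K, 1 < w α) :
    ∃ ρ : ℝ, 1 < ρ ∧ ∀ z : RepSpace α, ρ * ‖z‖ ≤ ‖diag α α * z‖ := by
  have hgap {ι : Type _} [Finite ι] (f : ι → ℝ) (hf : ∀ i, 1 < f i) : ∃ ρ > 1, ∀ i, ρ ≤ f i := by
    cases isEmpty_or_nonempty ι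
    · exact ⟨2, one_lt_two, isEmptyElim⟩
    · obtain ⟨i, hi⟩ := Finite.exists_min f
      exact ⟨f i, hf i, hi⟩
  obtain ⟨ρ, hρ, h⟩ := hgap (Sum.elim (fun w : InfinitePlace K => w α)
    fun v : DenomPrime α => ‖algebraMap K (v.1.adicCompletion K) α‖)
    (Sum.rec hα fun v => one_lt_norm_algebraMap_completion.2 v.2)
  refine ⟨ρ, hρ, fun z => ?_⟩
  rw [Prod.norm_def, Prod.norm_def, mul_max_of_nonneg _ _ (zero_le_one.trans hρ.le)]
  exact max_le_max (mul_norm_le_norm_mixedEmbedding_mul (fun w => h (.inl w)) z.1)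
    (mul_norm_le_norm_pi_mul (one_pos.trans hρ) (fun v => h (.inr v)) z.2)

theorem diag_injective (α : K) : Function.Injective (diag α) := fun _ _ h =>
  mixedEmbedding_injective K (congrArg Prod.fst h)

theorem place_le_norm_diag (α : K) (w : InfinitePlace K) (x : K) : w x ≤ ‖diag α x‖ := by
  rw [← normAtPlace_apply]
  exact (normAtPlace_le_norm w (diag α x).1).trans (norm_fst_le _)

theorem norm_algebraMap_le_norm_diag {α : K} (v : DenomPrime α) (x : K) :
    ‖algebraMap K (v.1.adicCompletion K) x‖ ≤ ‖diag α x‖ :=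
  (norm_le_pi_norm (diag α x).2 v).trans (norm_snd_le _)

/-- Multiplication by `Φ_α(ξ)` on `𝕂_α`. -/
noncomputable def mulDiag (α : K) (ξ : Kˣ) : RepSpace α ≃ₜ+ RepSpace α :=
  (ContinuousLinearEquiv.smulLeft (R₁ := ℤ)
    (Units.map (diag α : K →* RepSpace α) ξ)).toContinuousAddEquiv

theorem mulDiag_apply (α : K) (ξ : Kˣ) (z : RepSpace α) : mulDiag α ξ z = diag α ξ * z := rfl

theorem mulDiag_diag (α : K) (ξ : Kˣ) (x : K) : mulDiag α ξ (diag α x) = diag α (ξ * x) :=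
  (map_mul (diag α) _ _).symm

/-- The product of the rational primes below the primes `𝔭 ∣ 𝔟`: a positive integer that is
topologically nilpotent at each of them. -/
noncomputable def denomNat (α : K) : ℕ := ∏ v : DenomPrime α, primeBelow v.1

theorem denomNat_ne_zero (α : K) : denomNat α ≠ 0 :=
  Finset.prod_ne_zero_iff.2 fun v _ => (fact_primeBelow v.1).out.ne_zero

theorem norm_denomNat_lt_one {α : K} (v : DenomPrime α) :
    ‖(denomNat α : v.1.adicCompletion K)‖ < 1 := by
  have h : (denomNat α : v.1.adicCompletion K) =
      algebraMap ℚ (v.1.adicCompletion K) ((denomNat α : ℤ) : ℚ) := by simp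
  rw [h, norm_lt_one_iff, valued_intCast_lt_one_iff]
  exact_mod_cast Finset.dvd_prod_of_mem (fun v : DenomPrime α => primeBelow v.1) (Finset.mem_univ v)

theorem exists_norm_denomNat_pow_mul_lt (α : K) (B : ℝ) {ε : ℝ} (hε : 0 < ε) :
    ∃ k : ℕ, ∀ v : DenomPrime α, ‖(denomNat α : v.1.adicCompletion K)‖ ^ k * B < ε := by
  refine (eventually_all.2 fun v : DenomPrime α => ?_).exists (f := atTop)
  have hlim := (tendsto_pow_atTop_nhds_zero_of_lt_one (norm_nonneg _)
    (norm_denomNat_lt_one v)).mul_const B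
  rw [zero_mul] at hlim
  exact hlim.eventually (gt_mem_nhds hε)

theorem valuation_le_one_of_mem_adjoin {α x : K} (hx : x ∈ Algebra.adjoin ℤ {α})
    {v : HeightOneSpectrum (𝓞 K)} (hv : v.valuation K α ≤ 1) : v.valuation K x ≤ 1 := by
  have hle : Algebra.adjoin ℤ {α} ≤ subalgebraOfSubring (v.valuation K).integer :=
    Algebra.adjoin_le (Set.singleton_subset_iff.2 hv)
  exact hle hx

theorem isIntegral_denomNat_pow_mul {α x : K} (hx : x ∈ Algebra.adjoin ℤ {α}) {k : ℕ}
    (h : ∀ v : DenomPrime α,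
      ‖algebraMap K (v.1.adicCompletion K) ((denomNat α : K) ^ k * x)‖ ≤ 1) :
    IsIntegral ℤ ((denomNat α : K) ^ k * x) := by
  have hrange : (denomNat α : K) ^ k * x ∈ (algebraMap (𝓞 K) K).range := by
    refine HeightOneSpectrum.mem_integers_of_valuation_le_one K _ fun v => ?_
    by_cases hv : v.valuation K α ≤ 1
    · exact valuation_le_one_of_mem_adjoin (mul_mem (pow_mem (natCast_mem _ _) _) hx) hv
    · exact not_lt.1 fun hlt =>
        (h ⟨v, not_le.1 hv⟩).not_gt (one_lt_norm_algebraMap_completion.2 hlt)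
  obtain ⟨y, hy⟩ := hrange
  exact hy ▸ y.isIntegral_coe

theorem isBoundedlyFinite_diag_adjoin (α : K) :
    IsBoundedlyFinite (diag α '' (Algebra.adjoin ℤ {α} : Set K)) := by
  intro B
  obtain ⟨k, hk⟩ := exists_norm_denomNat_pow_mul_lt α B one_pos
  set N : K := (denomNat α : K) ^ k with hN
  have hN0 : N ≠ 0 := pow_ne_zero _ (Nat.cast_ne_zero.2 (denomNat_ne_zero α))
  refine ((Embeddings.finite_of_norm_le K ℂ (denomNat α ^ k * B)).image
    fun x => diag α (N⁻¹ * x)).subset ?_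
  rintro _ ⟨⟨x, hx, rfl⟩, hxB⟩
  refine ⟨N * x, ⟨isIntegral_denomNat_pow_mul hx fun v => ?_, fun φ => ?_⟩,
    congrArg (diag α) (inv_mul_cancel_left₀ hN0 x)⟩
  · rw [map_mul, norm_mul, map_pow, map_natCast, norm_pow]
    refine le_trans ?_ (hk v).le
    gcongr
    exact (norm_algebraMap_le_norm_diag v x).trans hxB
  · rw [hN, map_mul, norm_mul, map_pow, map_natCast, norm_pow, Complex.norm_natCast]
    gcongr
    exact (place_le_norm_diag α (InfinitePlace.mk φ) x).trans hxB

theorem dense_of_add_eq_univ {α : K} {H : AddSubgroup ((v : DenomPrime α) → v.1.adicCompletion K)}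
    {C : Set ((v : DenomPrime α) → v.1.adicCompletion K)} (hC : IsCompact C)
    (h : (H : Set ((v : DenomPrime α) → v.1.adicCompletion K)) + C = Set.univ) :
    Dense (H : Set ((v : DenomPrime α) → v.1.adicCompletion K)) := by
  refine fun z => Metric.mem_closure_iff.2 fun ε hε => ?_
  obtain ⟨B, hB⟩ := hC.isBounded.exists_norm_le
  obtain ⟨k, hk⟩ := exists_norm_denomNat_pow_mul_lt α B hε
  have hN0 (v : DenomPrime α) : (denomNat α : v.1.adicCompletion K) ^ k ≠ 0 := by
    have : CharZero (v.1.adicCompletion K) := algebraRat.charZero _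
    exact pow_ne_zero _ (Nat.cast_ne_zero.2 (denomNat_ne_zero α))
  obtain ⟨x, hx, c, hc, hxc⟩ := Set.mem_add.1 (h.symm ▸ Set.mem_univ
    fun v : DenomPrime α => ((denomNat α : v.1.adicCompletion K) ^ k)⁻¹ * z v)
  refine ⟨denomNat α ^ k • x, H.nsmul_mem hx _, ?_⟩
  rw [dist_eq_norm, pi_norm_lt_iff hε]
  intro v
  have hz : z v = (denomNat α : v.1.adicCompletion K) ^ k * (x v + c v) := by
    rw [← Pi.add_apply, hxc, mul_inv_cancel_left₀ (hN0 v)]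
  have hsub : (z - denomNat α ^ k • x) v = (denomNat α : v.1.adicCompletion K) ^ k * c v := by
    simp [hz, mul_add]
  rw [hsub, norm_mul, norm_pow]
  refine lt_of_le_of_lt ?_ (hk v)
  gcongr
  exact (norm_le_pi_norm c v).trans (hB c hc)

theorem eq_univ_of_isClopen_of_add_eq_univ {α : K} {U : Set (RepSpace α)} (hU : IsClopen U)
    (hU0 : U.Nonempty) {H : AddSubgroup (RepSpace α)} (hHU : (H : Set (RepSpace α)) + U ⊆ U)
    {C : Set (RepSpace α)} (hC : IsCompact C) (hcov : (H : Set (RepSpace α)) + C = Set.univ) :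
    U = Set.univ := by
  obtain ⟨u, hu⟩ := hU0
  refine Set.eq_univ_of_forall fun z => ?_
  let H₂ := H.map (AddMonoidHom.snd (mixedSpace K) ((v : DenomPrime α) → v.1.adicCompletion K))
  have hdense : Dense (H₂ : Set ((v : DenomPrime α) → v.1.adicCompletion K)) := by
    refine dense_of_add_eq_univ (hC.image continuous_snd) (Set.eq_univ_of_forall fun y => ?_)
    obtain ⟨h, hh, c, hc, hhc⟩ := Set.mem_add.1 (hcov.symm ▸ Set.mem_univ ((0, y) : RepSpace α))
    exact ⟨h.2, ⟨h, hh, rfl⟩, c.2, ⟨c, hc, rfl⟩, congrArg Prod.snd hhc⟩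
  have hslice : IsClosed {y | (z.1, y + u.2) ∈ U} := hU.isClosed.preimage (by fun_prop)
  have hsub : (H₂ : Set ((v : DenomPrime α) → v.1.adicCompletion K)) ⊆
      {y | (z.1, y + u.2) ∈ U} := by
    rintro _ ⟨h, hh, rfl⟩
    exact mem_of_isClopen_of_snd_eq hU (hHU (Set.add_mem_add hh hu)) rfl
  have hmem : z.2 - u.2 ∈ {y | (z.1, y + u.2) ∈ U} :=
    hslice.closure_subset_iff.2 hsub (hdense _)
  simpa using hmem

end RepresentationSpaceGeometry

section DigitSets

variable {K : Type*} [Field K] {α : K} {A : Polynomial ℤ} {𝒟 : Set K}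

theorem IsExpanding.coeff_zero_ne_zero (hexp : IsExpanding A) : A.coeff 0 ≠ 0 := fun h =>
  absurd (hexp 0 (by rw [← Polynomial.coeff_zero_eq_aeval_zero', h, map_zero])) (by simp)

theorem IsExpanding.one_lt_infinitePlace (hexp : IsExpanding A) (hα : Polynomial.aeval α A = 0)
    (w : InfinitePlace K) : 1 < w α := by
  rw [← w.norm_embedding_eq]
  refine hexp _ ?_
  rw [← RingHom.toIntAlgHom_apply, Polynomial.aeval_algHom_apply, hα, map_zero]

theorem IsExpanding.ne_zero [NumberField K] (hexp : IsExpanding A)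
    (hα : Polynomial.aeval α A = 0) : α ≠ 0 := by
  rintro rfl
  have := hexp.one_lt_infinitePlace hα (Classical.arbitrary (InfinitePlace K))
  rw [map_zero] at this
  exact this.not_ge zero_le_one

theorem IsPrimitiveMinpoly.dvd [CharZero K] (hA : IsPrimitiveMinpoly A α) {p : Polynomial ℤ}
    (hp : Polynomial.aeval α p = 0) : A ∣ p := by
  obtain ⟨hprim, hirr, hα⟩ := hA
  have hint : IsIntegral ℚ α := by
    refine IsAlgebraic.isIntegral ⟨A.map (algebraMap ℤ ℚ), ?_, ?_⟩
    · exact (Polynomial.map_ne_zero_iff (RingHom.injective_int _)).2 hirr.ne_zero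
    · rwa [Polynomial.aeval_map_algebraMap]
  have hminpoly (q : Polynomial ℤ) (hq : Polynomial.aeval α q = 0) :
      minpoly ℚ α ∣ q.map (algebraMap ℤ ℚ) :=
    minpoly.dvd ℚ α (by rwa [Polynomial.aeval_map_algebraMap])
  refine (hprim.dvd_iff_fraction_map_dvd_fraction_map ℚ).2 (dvd_trans ?_ (hminpoly p hp))
  exact (minpoly.irreducible hint).dvd_symm
    (hprim.irreducible_iff_irreducible_map_fraction_map.1 hirr) (hminpoly A hα)

/-- The element `α` of the ring `ℤ[α]`. -/
def adjoinGen (α : K) : Algebra.adjoin ℤ {α} := ⟨α, Algebra.self_mem_adjoin_singleton ℤ α⟩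

theorem adjoinGen_dvd_aeval_sub_coeff_zero (p : Polynomial ℤ) :
    adjoinGen α ∣ Polynomial.aeval (adjoinGen α) p - p.coeff 0 := by
  have h := congrArg (Polynomial.aeval (adjoinGen α)) p.divX_mul_X_add
  rw [map_add, map_mul, Polynomial.aeval_X, Polynomial.aeval_C, algebraMap_int_eq, eq_intCast] at h
  exact ⟨Polynomial.aeval (adjoinGen α) p.divX, by rw [← h, add_sub_cancel_right, mul_comm]⟩

theorem coe_aeval_adjoinGen (p : Polynomial ℤ) :
    (Polynomial.aeval (adjoinGen α) p : K) = Polynomial.aeval α p :=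
  (Subalgebra.aeval_coe _ (adjoinGen α) p).symm

theorem aeval_adjoinGen_surjective :
    Function.Surjective (Polynomial.aeval (R := ℤ) (adjoinGen α)) := fun x =>
  have ⟨p, hp⟩ := Algebra.adjoin_mem_exists_aeval ℤ α x.2
  ⟨p, Subtype.ext ((coe_aeval_adjoinGen p).trans hp)⟩

theorem IsPrimitiveMinpoly.adjoinGen_dvd_intCast_iff [CharZero K] (hA : IsPrimitiveMinpoly A α)
    (n : ℤ) : adjoinGen α ∣ n ↔ A.coeff 0 ∣ n := by
  constructor
  · rintro ⟨y, hn⟩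
    obtain ⟨p, rfl⟩ := aeval_adjoinGen_surjective y
    have hroot : Polynomial.aeval α (Polynomial.C n - Polynomial.X * p) = 0 := by
      rw [← coe_aeval_adjoinGen, map_sub, map_mul, Polynomial.aeval_X, Polynomial.aeval_C, ← hn,
        algebraMap_int_eq, eq_intCast, sub_self, ZeroMemClass.coe_zero]
    simpa using map_dvd Polynomial.constantCoeff (hA.dvd hroot)
  · rintro ⟨k, rfl⟩
    have h := adjoinGen_dvd_aeval_sub_coeff_zero (α := α) A
    rw [Subtype.ext ((coe_aeval_adjoinGen A).trans hA.2.2 : _ = ((0 : Algebra.adjoin ℤ {α}) : K)),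
      zero_sub, dvd_neg] at h
    exact_mod_cast h.mul_right k

theorem IsPrimitiveMinpoly.natCard_quotient_adjoinGen [CharZero K] (hA : IsPrimitiveMinpoly A α) :
    Nat.card (Algebra.adjoin ℤ {α} ⧸ Ideal.span {adjoinGen α}) = (A.coeff 0).natAbs := by
  let f := (Ideal.Quotient.mk (Ideal.span {adjoinGen α})).comp (Int.castRingHom _)
  have hsurj : Function.Surjective f := by
    intro z
    obtain ⟨x, rfl⟩ := Ideal.Quotient.mk_surjective z
    obtain ⟨p, rfl⟩ := aeval_adjoinGen_surjective x
    exact ⟨p.coeff 0, (Ideal.Quotient.eq.2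
      (Ideal.mem_span_singleton.2 (adjoinGen_dvd_aeval_sub_coeff_zero p))).symm⟩
  have hker : Ideal.span {A.coeff 0} = RingHom.ker f := by
    ext n
    rw [RingHom.mem_ker, Ideal.mem_span_singleton, ← hA.adjoinGen_dvd_intCast_iff,
      ← Ideal.mem_span_singleton]
    exact Ideal.Quotient.eq_zero_iff_mem.symm
  rw [← Nat.card_congr (RingHom.quotientKerEquivOfSurjective hsurj).toEquiv, ← hker,
    Nat.card_congr (Int.quotientSpanEquivZMod (A.coeff 0)).toEquiv, Nat.card_zmod]

theorem sub_mem_span_adjoinGen_iff {x y : K} (hx : x ∈ Algebra.adjoin ℤ {α})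
    (hy : y ∈ Algebra.adjoin ℤ {α}) :
    (⟨x, hx⟩ - ⟨y, hy⟩ : Algebra.adjoin ℤ {α}) ∈ Ideal.span {adjoinGen α} ↔
      ∃ z ∈ Algebra.adjoin ℤ {α}, x - y = α * z := by
  rw [Ideal.mem_span_singleton]
  exact ⟨fun ⟨z, hz⟩ => ⟨z, z.2, congrArg Subtype.val hz⟩,
    fun ⟨z, hz, h⟩ => ⟨⟨z, hz⟩, Subtype.ext h⟩⟩

theorem IsStandardDigitSet.eq_of_sub_eq_mul (h𝒟 : IsStandardDigitSet α 𝒟) {d d' y : K}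
    (hd : d ∈ 𝒟) (hd' : d' ∈ 𝒟) (hy : y ∈ Algebra.adjoin ℤ {α}) (h : d - d' = α * y) : d = d' :=
  (h𝒟.2 d (h𝒟.1 d hd)).unique ⟨hd, 0, zero_mem _, by simp⟩ ⟨hd', y, hy, h⟩

theorem IsStandardDigitSet.bijective_mk (h𝒟 : IsStandardDigitSet α 𝒟) :
    Function.Bijective fun d : 𝒟 =>
      Ideal.Quotient.mk (Ideal.span {adjoinGen α}) ⟨(d : K), h𝒟.1 d d.2⟩ := by
  constructor
  · intro d d' h
    obtain ⟨y, hy, hdd'⟩ := (sub_mem_span_adjoinGen_iff _ _).1 (Ideal.Quotient.eq.1 h)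
    exact Subtype.ext (h𝒟.eq_of_sub_eq_mul d.2 d'.2 hy hdd')
  · intro z
    obtain ⟨x, rfl⟩ := Ideal.Quotient.mk_surjective z
    obtain ⟨d, ⟨hd, hx⟩, -⟩ := h𝒟.2 x x.2
    exact ⟨⟨d, hd⟩, (Ideal.Quotient.eq.2 ((sub_mem_span_adjoinGen_iff x.2 _).2 hx)).symm⟩

theorem IsStandardDigitSet.ncard_eq [CharZero K] (h𝒟 : IsStandardDigitSet α 𝒟)
    (hA : IsPrimitiveMinpoly A α) : 𝒟.ncard = (A.coeff 0).natAbs := by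
  rw [← hA.natCard_quotient_adjoinGen, ← Nat.card_eq_of_bijective _ h𝒟.bijective_mk,
    Nat.card_coe_set_eq]

theorem IsStandardDigitSet.finite [CharZero K] (h𝒟 : IsStandardDigitSet α 𝒟)
    (hA : IsPrimitiveMinpoly A α) (ha : A.coeff 0 ≠ 0) : 𝒟.Finite :=
  Set.finite_of_ncard_ne_zero (by rwa [h𝒟.ncard_eq hA, Int.natAbs_ne_zero])

end DigitSets

section PadicFract

variable {p : ℕ} [Fact p.Prime]

theorem norm_padicFract_sub_le_one (x : ℚ_[p]) : ‖(padicFract x : ℚ_[p]) - x‖ ≤ 1 := by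
  have hp : (p : ℚ_[p]) ≠ 0 := by exact_mod_cast (Fact.out : p.Prime).ne_zero
  set k := (-x.valuation).toNat
  let y : ℤ_[p] := ⟨(p : ℚ_[p]) ^ k * x, padic_shift_norm_le x⟩
  obtain ⟨c, hc⟩ := Ideal.mem_span_singleton'.1 (PadicInt.appr_spec k y)
  have hx : (c : ℚ_[p]) * p ^ k = p ^ k * x - y.appr k := by
    simpa using congrArg ((↑) : ℤ_[p] → ℚ_[p]) hc
  have hfract : (padicFract x : ℚ_[p]) = y.appr k / p ^ k := by
    rw [padicFract]
    push_cast
    rfl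
  have hsub : (padicFract x : ℚ_[p]) - x = -c := by
    rw [hfract, sub_eq_iff_eq_add, div_eq_iff (pow_ne_zero _ hp)]
    linear_combination hx
  rw [hsub, norm_neg]
  exact c.norm_le_one

theorem exists_padicFract_eq_div_pow (x : ℚ_[p]) :
    ∃ (m : ℤ) (k : ℕ), padicFract x = m / (p : ℚ) ^ k :=
  ⟨_, _, congrArg (· / (p : ℚ) ^ _) (Int.cast_natCast _).symm⟩

theorem exists_eq_intCast_of_norm_le_one {q : ℚ} {m : ℤ} {k : ℕ} (hq : q = m / (p : ℚ) ^ k)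
    (hnorm : ‖(q : ℚ_[p])‖ ≤ 1) : ∃ n : ℤ, q = n := by
  have hp : (p : ℚ) ≠ 0 := by exact_mod_cast (Fact.out : p.Prime).ne_zero
  have hm : (m : ℚ) = p ^ k * q := by rw [hq, mul_div_cancel₀ _ (pow_ne_zero k hp)]
  have hle : ‖(m : ℚ_[p])‖ ≤ (p : ℝ) ^ (-(k : ℤ)) := by
    have hm' : (m : ℚ_[p]) = p ^ k * q := by exact_mod_cast congrArg ((↑) : ℚ → ℚ_[p]) hm
    rw [hm', norm_mul, Padic.norm_p_pow]
    exact mul_le_of_le_one_right (by positivity) hnorm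
  obtain ⟨n, rfl⟩ := (Padic.norm_int_le_pow_iff_dvd m k).1 hle
  exact ⟨n, by rw [hq]; push_cast; exact mul_div_cancel_left₀ _ (pow_ne_zero k hp)⟩

theorem exists_padicFract_neg_eq (x : ℚ_[p]) : ∃ n : ℤ, padicFract (-x) = n - padicFract x := by
  have hp : (p : ℚ) ≠ 0 := by exact_mod_cast (Fact.out : p.Prime).ne_zero
  obtain ⟨m, k, hm⟩ := exists_padicFract_eq_div_pow x
  obtain ⟨m', k', hm'⟩ := exists_padicFract_eq_div_pow (-x)
  have hsum : padicFract (-x) + padicFract x =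
      ((m' * p ^ k + p ^ k' * m : ℤ) : ℚ) / (p : ℚ) ^ (k' + k) := by
    rw [hm, hm', div_add_div _ _ (pow_ne_zero _ hp) (pow_ne_zero _ hp), pow_add]
    push_cast
    rfl
  have hnorm : ‖((padicFract (-x) + padicFract x : ℚ) : ℚ_[p])‖ ≤ 1 := by
    have h := (Padic.nonarchimedean _ _).trans
      (max_le (norm_padicFract_sub_le_one (-x)) (norm_padicFract_sub_le_one x))
    rw [sub_neg_eq_add, add_add_sub_cancel] at h
    exact_mod_cast h
  obtain ⟨n, hn⟩ := exists_eq_intCast_of_norm_le_one hsum hnorm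
  exact ⟨n, eq_sub_of_add_eq hn⟩

end PadicFract

section Characters

variable {K : Type*} [Field K] [NumberField K]

theorem charInfinite_neg (z : mixedSpace K) :
    charInfinite (-z) = (starRingEnd ℂ) (charInfinite z) := by
  simp only [charInfinite, map_mul, map_prod, ← Complex.exp_conj]
  simp [Complex.conj_ofNat]

theorem localTrace_neg (v : HeightOneSpectrum (𝓞 K)) (z : v.adicCompletion K) :
    localTrace v (-z) = -localTrace v z := by
  let := (padicToCompletion v).toAlgebra
  exact map_neg (Algebra.trace ℚ_[primeBelow v] (v.adicCompletion K)) z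

theorem charFinite_neg (v : HeightOneSpectrum (𝓞 K)) (z : v.adicCompletion K) :
    charFinite v (-z) = (starRingEnd ℂ) (charFinite v z) := by
  obtain ⟨n, hn⟩ := exists_padicFract_neg_eq (localTrace v z)
  rw [charFinite, charFinite, localTrace_neg, ← Complex.exp_conj, hn,
    Complex.exp_eq_exp_iff_exists_int]
  refine ⟨n, ?_⟩
  simp only [Rat.cast_sub, Rat.cast_intCast, map_mul, Complex.conj_ofNat, Complex.conj_ofReal,
    Complex.conj_I, map_ratCast]
  ring

theorem charRep_neg (α : K) (z : RepSpace α) :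
    charRep α (-z) = (starRingEnd ℂ) (charRep α z) := by
  rw [charRep, charRep, map_mul, map_prod, Prod.fst_neg, charInfinite_neg]
  simp only [Prod.snd_neg, Pi.neg_apply, charFinite_neg]

theorem charTwist_neg (α ξ : K) (z : RepSpace α) :
    charTwist α (-ξ) z = (starRingEnd ℂ) (charTwist α ξ z) := by
  rw [charTwist, map_neg, neg_mul, charRep_neg, charTwist]

theorem im_fourierInv_eq_zero (α : K) {V : Set K} [Fintype V] {σ : V → V}
    (hσ : ∀ x, (σ x : K) = -x) {s : V → ℝ} (hs : ∀ x, s (σ x) = s x) (z : RepSpace α) :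
    (fourierInv α V s z).im = 0 := by
  have hinv : Function.Involutive σ := fun x => Subtype.ext (by rw [hσ, hσ, neg_neg])
  rw [← Complex.conj_eq_iff_im]
  calc (starRingEnd ℂ) (∑ x : V, (s x : ℂ) * charTwist α x z)
      = ∑ x : V, (s (σ x) : ℂ) * charTwist α (σ x) z := by
        simp only [map_sum, map_mul, Complex.conj_ofReal, hs, hσ, charTwist_neg]
    _ = ∑ x : V, (s x : ℂ) * charTwist α x z :=
        Equiv.sum_comp (hinv.toPerm σ) fun x => (s x : ℂ) * charTwist α x z

theorem charInfiniteHom_zero : charInfiniteHom (0 : K) = 1 := by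
  ext z
  simp [charInfiniteHom, charInfinite_zero]

theorem not_const_fourierInv (α : K) {V : Set K} [Fintype V] (hV : (0 : K) ∉ V) {s : V → ℝ}
    (hs : s ≠ 0) : ¬ ∃ c : ℂ, ∀ z, fourierInv α V s z = c := by
  rintro ⟨c, hc⟩
  let freq : Option V → K := fun o => o.elim 0 (↑)
  have hfreq : Function.Injective freq :=
    Option.injective_iff.2 ⟨Subtype.val_injective, by
      rintro ⟨x, hx : (x : K) = 0⟩
      exact hV (hx ▸ x.2)⟩
  have hli := Fintype.linearIndependent_iff.1
    ((linearIndependent_monoidHom (Multiplicative (mixedSpace K)) ℂ).comp _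
      (charInfiniteHom_injective.comp hfreq))
  refine hs (funext fun x => Complex.ofReal_eq_zero.1 ?_)
  refine hli (fun o => o.elim (-c) fun x => (s x : ℂ)) (funext fun z => ?_) (some x)
  have hz : ∑ x : V, (s x : ℂ) * charInfiniteHom (x : K) z = c := by
    rw [← hc (z.toAdd, 0)]
    exact Finset.sum_congr rfl fun x _ => by rw [charTwist_infinite, ofAdd_toAdd]
  simp [Fintype.sum_option, freq, charInfiniteHom_zero, hz]

end Characters

section DigitModule

variable {K : Type*} [Field K] {α : K} {𝒟 : Set K}

theorem sub_mem_digitModule {d d' : K} (hd : d ∈ 𝒟) (hd' : d' ∈ 𝒟) : d - d' ∈ digitModule α 𝒟 :=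
  Submodule.mem_sInf.2 fun _ hM => hM.1 d hd d' hd'

theorem mul_mem_digitModule {x : K} (hx : x ∈ digitModule α 𝒟) : α * x ∈ digitModule α 𝒟 :=
  Submodule.mem_sInf.2 fun M hM => hM.2 x (Submodule.mem_sInf.1 hx M hM)

theorem IsStandardDigitSet.digitModule_le (h𝒟 : IsStandardDigitSet α 𝒟) :
    digitModule α 𝒟 ≤ Subalgebra.toSubmodule (Algebra.adjoin ℤ {α}) :=
  sInf_le ⟨fun d hd d' hd' => sub_mem (h𝒟.1 d hd) (h𝒟.1 d' hd'),
    fun _ hx => Subalgebra.mul_mem _ (Algebra.self_mem_adjoin_singleton ℤ α) hx⟩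

theorem contactMatrix_neg {V : Set K} {σ : V → V} (hσ : ∀ x, (σ x : K) = -x) (x y : V) :
    contactMatrix α 𝒟 V (σ x) (σ y) = contactMatrix α 𝒟 V x y := by
  have htranslate : (α * (x : K) + y) +ᵥ
      (((fun d => α * (σ x : K) + d) '' 𝒟) ∩ ((fun d => (σ y : K) + d) '' 𝒟)) =
      ((fun d => α * (x : K) + d) '' 𝒟) ∩ ((fun d => (y : K) + d) '' 𝒟) := by
    rw [Set.vadd_set_inter, Set.inter_comm, ← Set.image_vadd, ← Set.image_vadd, Set.image_image,
      Set.image_image]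
    simp only [hσ, vadd_eq_add]
    congr 2 <;> ext d <;> ring
  simp only [contactMatrix, Matrix.of_apply]
  rw [← htranslate, Set.ncard_vadd_set]

end DigitModule

section ContactSet

open scoped Classical

variable {K : Type*} [Field K] [NumberField K] {α : K} {𝒟 : Set K} {D : Set (RepSpace α)} {x : K}

theorem translate_eq_vadd (D : Set (RepSpace α)) (x : K) : translate α D x = diag α x +ᵥ D := by
  simp only [translate, ← Set.image_vadd, vadd_eq_add, add_comm]

theorem mem_digitModule_and_ne_zero_of_mem_contactSet (hx : x ∈ contactSet α 𝒟 D) :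
    x ∈ digitModule α 𝒟 ∧ x ≠ 0 := by
  obtain ⟨k, hk⟩ := Set.mem_iUnion.1 hx
  cases k with
  | zero => exact ⟨hk.1, hk.2.1⟩
  | succ k => exact ⟨hk.1, hk.2.1⟩

theorem mem_contactSet_of_inter_nonempty (hx : x ∈ digitModule α 𝒟) (hx0 : x ≠ 0)
    (h : (D ∩ (diag α x +ᵥ D)).Nonempty) : x ∈ contactSet α 𝒟 D :=
  Set.mem_iUnion.2 ⟨0, hx, hx0, by rwa [translate_eq_vadd]⟩

theorem mem_contactSet_of_mul_add_eq {y d d' : K} (hy : y ∈ contactSet α 𝒟 D)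
    (hx : x ∈ digitModule α 𝒟) (hx0 : x ≠ 0) (hd : d ∈ 𝒟) (hd' : d' ∈ 𝒟)
    (h : α * x + d = y + d') : x ∈ contactSet α 𝒟 D := by
  obtain ⟨k, hk⟩ := Set.mem_iUnion.1 hy
  exact Set.mem_iUnion.2 ⟨k + 1, hx, hx0, y, hk, _, ⟨d, hd, rfl⟩, d', hd', h.symm⟩

theorem neg_mem_contactStep {k : ℕ} (hx : x ∈ contactStep α 𝒟 D k) :
    -x ∈ contactStep α 𝒟 D k := by
  induction k generalizing x with
  | zero =>
    obtain ⟨hx, hx0, δ, hδ, δ', hδ', h⟩ := hx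
    refine ⟨neg_mem hx, neg_ne_zero.2 hx0, δ', hδ', δ, hδ, ?_⟩
    simp only at h ⊢
    rw [← h, map_neg, add_neg_cancel_right]
  | succ k ih =>
    obtain ⟨hx, hx0, y, hy, _, ⟨d, hd, rfl⟩, d', hd', h⟩ := hx
    refine ⟨neg_mem hx, neg_ne_zero.2 hx0, -y, ih hy, _, ⟨d', hd', rfl⟩, d, hd, ?_⟩
    linear_combination -h

theorem neg_mem_contactSet (hx : x ∈ contactSet α 𝒟 D) : -x ∈ contactSet α 𝒟 D := by
  obtain ⟨k, hk⟩ := Set.mem_iUnion.1 hx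
  exact Set.mem_iUnion.2 ⟨k, neg_mem_contactStep hk⟩

theorem exists_norm_diag_le_of_mem_contactSet (hα : ∀ w : InfinitePlace K, 1 < w α)
    (hfin : 𝒟.Finite) (hD : IsCompact D) : ∃ B, ∀ x ∈ contactSet α 𝒟 D, ‖diag α x‖ ≤ B := by
  obtain ⟨ρ, hρ, hexp⟩ := exists_expansion hα
  obtain ⟨M, hM⟩ := hD.isBounded.exists_norm_le
  obtain ⟨c, hc⟩ := (hfin.image (diag α)).isBounded.exists_norm_le
  -- `B` is chosen so that `(B + 2 c) / ρ ≤ B`.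
  set B := max (M + M) (2 * c / (ρ - 1))
  have hcB : 2 * c ≤ B * (ρ - 1) := (div_le_iff₀ (sub_pos.2 hρ)).1 (le_max_right _ _)
  have hstep (k : ℕ) (x : K) (hx : x ∈ contactStep α 𝒟 D k) : ‖diag α x‖ ≤ B := by
    induction k generalizing x with
    | zero =>
      obtain ⟨-, -, δ, hδ, δ', hδ', h⟩ := hx
      rw [eq_sub_of_add_eq' h]
      exact ((norm_sub_le _ _).trans (add_le_add (hM _ hδ) (hM _ hδ'))).trans (le_max_left _ _)
    | succ k ih =>
      obtain ⟨-, -, y, hy, _, ⟨d, hd, rfl⟩, d', hd', h⟩ := hx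
      have hαx : diag α α * diag α x = diag α y + (diag α d' - diag α d) := by
        rw [← map_mul, ← map_sub, ← map_add]
        congr 1
        linear_combination -h
      have hρB : ρ * ‖diag α x‖ ≤ ρ * B := calc
        ρ * ‖diag α x‖ ≤ ‖diag α y + (diag α d' - diag α d)‖ := hαx ▸ hexp _
        _ ≤ B + (c + c) := norm_add_le_of_le (ih y hy)
          (norm_sub_le_of_le (hc _ ⟨d', hd', rfl⟩) (hc _ ⟨d, hd, rfl⟩))
        _ ≤ ρ * B := by linarith
      exact le_of_mul_le_mul_left hρB (by linarith)
  exact ⟨B, fun x hx => (Set.mem_iUnion.1 hx).elim fun k => hstep k x⟩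

theorem finite_contactSet (hα : ∀ w : InfinitePlace K, 1 < w α) (h𝒟 : IsStandardDigitSet α 𝒟)
    (hfin : 𝒟.Finite) (hD : IsCompact D) : (contactSet α 𝒟 D).Finite := by
  obtain ⟨B, hB⟩ := exists_norm_diag_le_of_mem_contactSet hα hfin hD
  refine ((isBoundedlyFinite_diag_adjoin α B).subset ?_).of_finite_image (diag_injective α).injOn
  rintro _ ⟨x, hx, rfl⟩
  exact ⟨⟨x, h𝒟.digitModule_le (mem_digitModule_and_ne_zero_of_mem_contactSet hx).1, rfl⟩, hB x hx⟩

end ContactSet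

theorem not_isClopen_of_isCompact {X Y : Type*} [TopologicalSpace X] [TopologicalSpace Y]
    [PreconnectedSpace X] [NoncompactSpace X] {D : Set (X × Y)} (hD : IsCompact D)
    (hD0 : D.Nonempty) : ¬ IsClopen D := by
  intro hclopen
  obtain ⟨u, hu⟩ := hD0
  have huniv : Prod.fst '' D = Set.univ := Set.eq_univ_of_forall fun x =>
    ⟨(x, u.2), mem_of_isClopen_of_snd_eq hclopen hu rfl, rfl⟩
  exact noncompact_univ X (huniv ▸ hD.image continuous_fst)

theorem map_mul_mem_of_mem_adjoin {R S : Type*} [Ring R] [Ring S] (f : R →+* S) {a x : R}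
    {H : AddSubgroup S} (hH : ∀ z ∈ H, f a * z ∈ H) (hx : x ∈ Algebra.adjoin ℤ {a}) {z : S}
    (hz : z ∈ H) : f x * z ∈ H := by
  induction hx using Algebra.adjoin_induction generalizing z with
  | mem x hx => exact (Set.mem_singleton_iff.1 hx) ▸ hH z hz
  | algebraMap n => simpa [← zsmul_eq_mul] using H.zsmul_mem hz n
  | add x y _ _ hx hy => rw [map_add, add_mul]; exact H.add_mem (hx hz) (hy hz)
  | mul x y _ _ hx hy => rw [map_mul, mul_assoc]; exact hx (hy hz)

section LatticeOfDigitModule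

open scoped Classical

variable {K : Type*} [Field K] [NumberField K] {α : K} {𝒟 : Set K} {M : Submodule ℤ K}
  {D : Set (RepSpace α)} {H : AddSubgroup (RepSpace α)}

/-- The image `Φ_α(M)` of a `ℤ`-module `M ⊆ K` in `𝕂_α`. For `M ⊆ ℤ[α]` this is a discrete group of
translations. -/
noncomputable def diagMap (α : K) (M : Submodule ℤ K) : AddSubgroup (RepSpace α) :=
  M.toAddSubgroup.map (diag α : K →+ RepSpace α)

theorem diag_mem_diagMap {x : K} (hx : x ∈ M) : diag α x ∈ diagMap α M := ⟨x, hx, rfl⟩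

theorem isBoundedlyFinite_diagMap (hM : M ≤ Subalgebra.toSubmodule (Algebra.adjoin ℤ {α})) :
    IsBoundedlyFinite (diagMap α M : Set (RepSpace α)) :=
  (isBoundedlyFinite_diag_adjoin α).mono (Set.image_mono hM)

theorem translates_eq_image (𝒟 : Set K) (D : Set (RepSpace α)) :
    translates α 𝒟 D = (fun z => z +ᵥ D) '' (diagMap α (digitModule α 𝒟) : Set (RepSpace α)) := by
  rw [translates, funext (translate_eq_vadd D)]
  exact (Set.image_image (fun z => z +ᵥ D) (diag α) (digitModule α 𝒟)).symm

theorem add_image_mulDiag_eq_univ (hM : M ≤ Subalgebra.toSubmodule (Algebra.adjoin ℤ {α}))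
    (hH : ∀ z ∈ H, diag α α * z ∈ H) (hcov : (diagMap α M : Set (RepSpace α)) + D = Set.univ)
    {a : Kˣ} (ha : diag α (a : K) ∈ H) : (H : Set (RepSpace α)) + mulDiag α a '' D = Set.univ := by
  refine Set.eq_univ_of_forall fun z => ?_
  obtain ⟨w, rfl⟩ := (mulDiag α a).surjective z
  obtain ⟨_, ⟨x, hx, rfl⟩, δ, hδ, rfl⟩ : w ∈ (diagMap α M : Set (RepSpace α)) + D :=
    hcov ▸ Set.mem_univ w
  rw [map_add, mulDiag_apply, mul_comm]
  exact Set.add_mem_add (map_mul_mem_of_mem_adjoin (diag α) hH (hM hx) ha)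
    (Set.mem_image_of_mem _ hδ)

theorem diagMap_le_of_neighbors_mem (hM : M ≤ Subalgebra.toSubmodule (Algebra.adjoin ℤ {α}))
    (hHM : H ≤ diagMap α M) (hH : ∀ z ∈ H, diag α α * z ∈ H) (hD : IsCompact D)
    (hcov : (diagMap α M : Set (RepSpace α)) + D = Set.univ)
    (hnb : ∀ z ∈ diagMap α M, (D ∩ (z +ᵥ D)).Nonempty → z ∈ H) : diagMap α M ≤ H := by
  have hclopen : IsClopen ((H : Set (RepSpace α)) + D) :=
    isClopen_add (isBoundedlyFinite_diagMap hM) hHM hD hcov hnb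
  have hD0 : D.Nonempty := Set.Nonempty.of_add_right (hcov ▸ Set.univ_nonempty)
  have huniv : (H : Set (RepSpace α)) + D = Set.univ := by
    obtain rfl | ⟨z, hz, hz0⟩ := H.bot_or_exists_ne_zero
    · rw [AddSubgroup.coe_bot, Set.singleton_zero, zero_add] at hclopen
      exact absurd hclopen (not_isClopen_of_isCompact hD hD0)
    · obtain ⟨a, -, rfl⟩ := hHM hz
      have ha0 : a ≠ 0 := fun ha => hz0 (by rw [ha, map_zero])
      refine eq_univ_of_isClopen_of_add_eq_univ hclopen (Set.Nonempty.add ⟨0, H.zero_mem⟩ hD0) ?_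
        (hD.image (mulDiag α (Units.mk0 a ha0)).continuous)
        (add_image_mulDiag_eq_univ hM hH hcov hz)
      rw [← add_assoc, coe_add_coe]
  obtain ⟨δ, hδ⟩ := hD0
  exact fun z hz => mem_of_add_mem_add hHM hnb hz hδ (huniv ▸ Set.mem_univ _)

end LatticeOfDigitModule

section TilingCriterion

open scoped Classical

variable {K : Type*} [Field K] [NumberField K] {α : K} {𝒟 : Set K} {D F : Set (RepSpace α)}
  {E : Finset (RepSpace α)}

/-- The expanding map `z ↦ α · z` of `𝕂_α`. -/
noncomputable abbrev expansion (α : K) (hα0 : α ≠ 0) : RepSpace α ≃ₜ+ RepSpace α :=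
  mulDiag α (Units.mk0 α hα0)

theorem IsSelfAffineTile.isSelfAffine (hF : IsSelfAffineTile α 𝒟 F) (hα0 : α ≠ 0)
    (hE : (E : Set (RepSpace α)) = diag α '' 𝒟) :
    IsSelfAffine (expansion α hα0 : RepSpace α →+ RepSpace α) E F := by
  refine ⟨hF.1, hF.2.1, ?_⟩
  rw [hE, ← Set.iUnion_add_left_image, Set.biUnion_image]
  refine hF.2.2.trans ?_
  simp only [translate, add_comm]

theorem contactMatrix_eq_contactCount (hα0 : α ≠ 0) (hE : (E : Set (RepSpace α)) = diag α '' 𝒟)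
    (V : Set K) : contactMatrix α 𝒟 V = Matrix.of fun x y : V => (contactCount
      (expansion α hα0 : RepSpace α →+ RepSpace α) E (diag α x) (diag α y) : ℝ) := by
  ext x y
  have himage (z : K) : diag α z +ᵥ (E : Set (RepSpace α)) = diag α '' ((fun d => z + d) '' 𝒟) := by
    rw [hE, ← Set.image_vadd, Set.image_image, Set.image_image]
    simp only [vadd_eq_add, map_add]
  have hexp : (expansion α hα0 : RepSpace α →+ RepSpace α) (diag α x) = diag α (α * x) :=
    mulDiag_diag α _ _
  rw [contactMatrix, Matrix.of_apply, Matrix.of_apply, contactCount, hexp, ← Set.ncard_coe_finset,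
    Finset.coe_inter, Finset.coe_vadd_finset, Finset.coe_vadd_finset, himage, himage,
    ← Set.image_inter (diag_injective α), Set.ncard_image_of_injective _ (diag_injective α)]

theorem IsStandardDigitSet.eq_of_sub_eq_expansion (h𝒟 : IsStandardDigitSet α 𝒟) (hα0 : α ≠ 0)
    (hE : (E : Set (RepSpace α)) = diag α '' 𝒟) {M : Submodule ℤ K}
    (hM : M ≤ Subalgebra.toSubmodule (Algebra.adjoin ℤ {α})) :
    ∀ d ∈ E, ∀ d' ∈ E, ∀ y ∈ diagMap α M, d - d' = expansion α hα0 y → d = d' := by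
  simp only [← Finset.mem_coe, hE]
  rintro _ ⟨d, hd, rfl⟩ _ ⟨d', hd', rfl⟩ _ ⟨y, hy, rfl⟩ h
  rw [h𝒟.eq_of_sub_eq_mul hd hd' (hM hy) (diag_injective α ?_)]
  rwa [map_sub, map_mul]

theorem IsStandardDigitSet.isDigitSystem_adjoin (h𝒟 : IsStandardDigitSet α 𝒟) (hα0 : α ≠ 0)
    (hE : (E : Set (RepSpace α)) = diag α '' 𝒟) :
    IsDigitSystem (expansion α hα0 : RepSpace α →+ RepSpace α) E
      (diagMap α (Subalgebra.toSubmodule (Algebra.adjoin ℤ {α}))) := by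
  have huniq := h𝒟.eq_of_sub_eq_expansion hα0 hE le_rfl
  refine ⟨(expansion α hα0).injective, ?_, ?_, ?_, ?_, huniq⟩
  · obtain ⟨d, hd, -⟩ := (h𝒟.2 0 (zero_mem _)).exists
    exact ⟨diag α d, Finset.mem_coe.1 (hE ▸ ⟨d, hd, rfl⟩)⟩
  · rintro _ ⟨x, hx, rfl⟩
    exact ⟨α * x, Subalgebra.mul_mem _ (Algebra.self_mem_adjoin_singleton ℤ α) hx,
      map_mul (diag α) _ _⟩
  · simp only [← Finset.mem_coe, hE]
    rintro _ ⟨d, hd, rfl⟩ _ ⟨d', hd', rfl⟩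
    exact ⟨d - d', sub_mem (h𝒟.1 d hd) (h𝒟.1 d' hd'), map_sub _ _ _⟩
  · simp only [← Finset.mem_coe, hE]
    rintro _ ⟨x, hx, rfl⟩ _ ⟨d', hd', rfl⟩
    obtain ⟨d, hd, y, hy, hxy⟩ := (h𝒟.2 (x + d') (add_mem hx (h𝒟.1 d' hd'))).exists
    refine ⟨_, ⟨d, hd, rfl⟩, diag α y, diag_mem_diagMap hy, ?_⟩
    change diag α x + diag α d' = diag α d + diag α α * diag α y
    rw [← map_mul, ← hxy, ← map_add, ← map_add, add_sub_cancel]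

theorem sum_contactMatrix_le (h𝒟 : IsStandardDigitSet α 𝒟) (hfin : 𝒟.Finite) (hα0 : α ≠ 0)
    {V : Set K} [Fintype V] (hV : V ⊆ Subalgebra.toSubmodule (Algebra.adjoin ℤ {α})) (y : V) :
    ∑ x, contactMatrix α 𝒟 V x y ≤ 𝒟.ncard := by
  obtain ⟨E, hE⟩ := (hfin.image (diag α)).exists_finset_coe
  rw [contactMatrix_eq_contactCount hα0 hE, ← Set.ncard_image_of_injective 𝒟 (diag_injective α),
    ← hE, Set.ncard_coe_finset]
  have hle := (h𝒟.isDigitSystem_adjoin hα0 hE).sum_contactCount_le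
    (v := fun x : V => diag α (x : K)) ((diag_injective α).comp Subtype.val_injective)
    (fun x => diag_mem_diagMap (hV x.2)) (diag α (y : K))
  simpa only [Matrix.of_apply, ← Nat.cast_sum, Nat.cast_le] using hle

theorem exists_le_norm_expansion (hα : ∀ w : InfinitePlace K, 1 < w α) (hα0 : α ≠ 0) :
    ∃ ρ : ℝ, 1 < ρ ∧ ∀ z : RepSpace α,
      ρ * ‖z‖ ≤ ‖(expansion α hα0 : RepSpace α →+ RepSpace α) z‖ :=
  exists_expansion hα

theorem addEquivAddHaarChar_expansion_le_card (hα : ∀ w : InfinitePlace K, 1 < w α)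
    (h𝒟 : IsStandardDigitSet α 𝒟) (hα0 : α ≠ 0) (hE : (E : Set (RepSpace α)) = diag α '' 𝒟)
    (hF : IsSelfAffineTile α 𝒟 F) (hDc : IsCompact D)
    (hcov : (diagMap α (digitModule α 𝒟) : Set (RepSpace α)) + D = Set.univ) :
    addEquivAddHaarChar (expansion α hα0) ≤ E.card := by
  obtain ⟨ρ, hρ, hexp⟩ := exists_le_norm_expansion hα hα0
  have hR := isBoundedlyFinite_diagMap (α := α) le_rfl
  have hFE := hF.isSelfAffine hα0 hE
  refine addEquivAddHaarChar_le_card hR hFE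
    (hFE.add_eq_univ hρ hexp (h𝒟.isDigitSystem_adjoin hα0 hE) hR hDc ?_)
  exact Set.eq_univ_of_univ_subset
    (hcov ▸ Set.add_subset_add_right (Set.image_mono h𝒟.digitModule_le))

theorem isDigitSystem_digitModule (hα : ∀ w : InfinitePlace K, 1 < w α)
    (h𝒟 : IsStandardDigitSet α 𝒟) (hα0 : α ≠ 0) (hE : (E : Set (RepSpace α)) = diag α '' 𝒟)
    (hF : IsSelfAffineTile α 𝒟 F) (hDc : IsCompact D)
    (hD : IsAddFundamentalDomain (diagMap α (digitModule α 𝒟)) D (repMeasure α)) :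
    IsDigitSystem (expansion α hα0 : RepSpace α →+ RepSpace α) E (diagMap α (digitModule α 𝒟)) := by
  have hΛ := isBoundedlyFinite_diagMap h𝒟.digitModule_le
  refine isDigitSystem_of_addEquivAddHaarChar_le_card hΛ hDc hD ?_
    (h𝒟.isDigitSystem_adjoin hα0 hE).nonempty ?_
    (h𝒟.eq_of_sub_eq_expansion hα0 hE h𝒟.digitModule_le)
    (addEquivAddHaarChar_expansion_le_card hα h𝒟 hα0 hE hF hDc
      (add_eq_univ_of_isAddFundamentalDomain hΛ hDc hD))
  · rintro _ ⟨x, hx, rfl⟩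
    exact ⟨α * x, mul_mem_digitModule hx, map_mul (diag α) _ _⟩
  · simp only [← Finset.mem_coe, hE]
    rintro _ ⟨d, hd, rfl⟩ _ ⟨d', hd', rfl⟩
    exact ⟨d - d', sub_mem_digitModule hd hd', map_sub _ _ _⟩

theorem diagMap_digitModule_le_almostStabilizer (h𝒟 : IsStandardDigitSet α 𝒟) (hα0 : α ≠ 0)
    (hE : (E : Set (RepSpace α)) = diag α '' 𝒟)
    (hsys : IsDigitSystem (expansion α hα0 : RepSpace α →+ RepSpace α) E
      (diagMap α (digitModule α 𝒟)))
    (hDc : IsCompact D) (hcov : (diagMap α (digitModule α 𝒟) : Set (RepSpace α)) + D = Set.univ)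
    [Fintype (contactSet α 𝒟 D)] (hno : ∀ t : contactSet α 𝒟 D → ℝ,
      (contactMatrix α 𝒟 (contactSet α 𝒟 D)).mulVec t = (𝒟.ncard : ℝ) • t → t = 0) :
    diagMap α (digitModule α 𝒟) ≤
      almostStabilizer (expansion α hα0 : RepSpace α →+ RepSpace α) E := by
  set T := (expansion α hα0 : RepSpace α →+ RepSpace α)
  have hclosed (y : contactSet α 𝒟 D) (z : RepSpace α) (hz : z ∈ diagMap α (digitModule α 𝒟))
      (hz0 : z ≠ 0) (h : ((T z +ᵥ E) ∩ (diag α (y : K) +ᵥ E)).Nonempty) :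
      z ∈ Set.range fun x : contactSet α 𝒟 D => diag α (x : K) := by
    obtain ⟨x, hx, rfl⟩ := hz
    simp only [← Finset.coe_nonempty, Finset.coe_inter, Finset.coe_vadd_finset, hE] at h
    obtain ⟨_, ⟨_, ⟨d, hd, rfl⟩, rfl⟩, _, ⟨d', hd', rfl⟩, heq⟩ := h
    refine ⟨⟨x, mem_contactSet_of_mul_add_eq y.2 hx (fun hx0 => hz0 ?_) hd hd' ?_⟩, rfl⟩
    · exact hx0 ▸ map_zero (diag α)
    · apply diag_injective α
      rw [map_add, map_add, map_mul]
      exact heq.symm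
  have hstab (x : contactSet α 𝒟 D) : diag α (x : K) ∈ almostStabilizer T E := by
    refine hsys.mem_almostStabilizer (v := fun x : contactSet α 𝒟 D => diag α (x : K))
      ((diag_injective α).comp Subtype.val_injective)
      (fun x => diag_mem_diagMap (mem_digitModule_and_ne_zero_of_mem_contactSet x.2).1) hclosed ?_ x
    rwa [contactMatrix_eq_contactCount hα0 hE, ← Set.ncard_image_of_injective 𝒟 (diag_injective α),
      ← hE, Set.ncard_coe_finset] at hno
  refine (diagMap_le_of_neighbors_mem (H := diagMap α (digitModule α 𝒟) ⊓ almostStabilizer T E)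
    h𝒟.digitModule_le inf_le_left ?_ hDc hcov ?_).trans inf_le_right
  · exact fun z hz => ⟨hsys.map_mem z hz.1, map_mem_almostStabilizer hz.2⟩
  · rintro _ ⟨x, hx, rfl⟩ hne
    refine ⟨diag_mem_diagMap hx, ?_⟩
    obtain rfl | hx0 := eq_or_ne x 0
    · exact (map_zero (diag α)).symm ▸ zero_mem _
    · exact hstab ⟨x, mem_contactSet_of_inter_nonempty hx hx0 hne⟩

theorem isTiling_of_contactMatrix (hα : ∀ w : InfinitePlace K, 1 < w α)
    (h𝒟 : IsStandardDigitSet α 𝒟) (hfin : 𝒟.Finite) (hα0 : α ≠ 0) (hF : IsSelfAffineTile α 𝒟 F)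
    (hDc : IsCompact D) (hD : IsTiling (repMeasure α) (translates α 𝒟 D))
    [Fintype (contactSet α 𝒟 D)] (hno : ∀ t : contactSet α 𝒟 D → ℝ,
      (contactMatrix α 𝒟 (contactSet α 𝒟 D)).mulVec t = (𝒟.ncard : ℝ) • t → t = 0) :
    IsTiling (repMeasure α) (translates α 𝒟 F) := by
  obtain ⟨E, hE⟩ := (hfin.image (diag α)).exists_finset_coe
  obtain ⟨ρ, hρ, hexp⟩ := exists_le_norm_expansion hα hα0
  have hΛ := isBoundedlyFinite_diagMap h𝒟.digitModule_le
  have : IsAddTorsionFree (RepSpace α) := .of_module_rat _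
  rw [translates_eq_image] at hD ⊢
  have hfund := isAddFundamentalDomain_of_isTiling hΛ hDc hD
  have hcov := add_eq_univ_of_isAddFundamentalDomain hΛ hDc hfund
  have hsys := isDigitSystem_digitModule hα h𝒟 hα0 hE hF hDc hfund
  have hFE := hF.isSelfAffine hα0 hE
  exact isTiling_of_isAddFundamentalDomain hΛ hF.2.1
    (isAddFundamentalDomain_of_le_almostStabilizer hFE hsys
      (hsys.card_le_addEquivAddHaarChar hΛ hDc hfund)
      (hFE.add_eq_univ hρ hexp hsys hΛ hDc hcov)
      (diagMap_digitModule_le_almostStabilizer h𝒟 hα0 hE hsys hDc hcov hno))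

end TilingCriterion

end SelfAffine

theorem mainTheorem9 {K : Type*} [Field K] [NumberField K] (α : K)
    (hα : IntermediateField.adjoin ℚ {α} = ⊤)
    (A : Polynomial ℤ) (hA : IsPrimitiveMinpoly A α) (hexp : IsExpanding A)
    (𝒟 : Set K) (h𝒟 : IsStandardDigitSet α 𝒟)
    (F : Set (RepSpace α)) (hF : IsSelfAffineTile α 𝒟 F)
    (D : Set (RepSpace α)) (hDc : IsCompact D)
    (hD : IsTiling (repMeasure α) (translates α 𝒟 D)) :
    ∃ hV : (contactSet α 𝒟 D).Finite,
      letI : Fintype (contactSet α 𝒟 D) := hV.fintype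
      ¬ IsTiling (repMeasure α) (translates α 𝒟 F) →
        ∃ f : OmegaHat α (contactSet α 𝒟 D),
          (¬ ∃ c : ℂ, ∀ z, (f : RepSpace α → ℂ) z = c) ∧
          (∀ z, ((f : RepSpace α → ℂ) z).im = 0) ∧
          contactHat α 𝒟 (contactSet α 𝒟 D) f = ((|A.coeff 0| : ℤ) : ℝ) • f := by
  have hw := hexp.one_lt_infinitePlace hA.2.2
  have hα0 := hexp.ne_zero hA.2.2
  have hfin := h𝒟.finite hA hexp.coeff_zero_ne_zero
  refine ⟨finite_contactSet hw h𝒟 hfin hDc, fun hnot => ?_⟩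
  let : Fintype (contactSet α 𝒟 D) := (finite_contactSet hw h𝒟 hfin hDc).fintype
  have hq : ((|A.coeff 0| : ℤ) : ℝ) = 𝒟.ncard := by
    rw [h𝒟.ncard_eq hA, ← Int.natCast_natAbs, Int.cast_natCast]
  obtain ⟨t, ht, ht0⟩ : ∃ t : contactSet α 𝒟 D → ℝ,
      (contactMatrix α 𝒟 (contactSet α 𝒟 D)).mulVec t = (𝒟.ncard : ℝ) • t ∧ t ≠ 0 := by
    by_contra! hno
    exact hnot (isTiling_of_contactMatrix hw h𝒟 hfin hα0 hF hDc hD hno)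
  let σ (x : contactSet α 𝒟 D) : contactSet α 𝒟 D := ⟨-x, neg_mem_contactSet x.2⟩
  have hσ (x : contactSet α 𝒟 D) : (σ x : K) = -x := rfl
  obtain ⟨s, hs0, hsσ, hs⟩ := exists_invariant_eigenvector (C := contactMatrix α 𝒟 _)
    (fun x y => Nat.cast_nonneg _) (sum_contactMatrix_le h𝒟 hfin hα0 fun x hx =>
      h𝒟.digitModule_le (mem_digitModule_and_ne_zero_of_mem_contactSet hx).1)
    (Nat.cast_nonneg _) (σ := σ) (fun x => Subtype.ext (neg_neg (x : K)))
    (contactMatrix_neg hσ) ht ht0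
  refine ⟨(fourierCoeffs α _).symm s, not_const_fourierInv α
    (fun h0 => (mem_digitModule_and_ne_zero_of_mem_contactSet h0).2 rfl) hs0,
    im_fourierInv_eq_zero α hσ hsσ, ?_⟩
  simp only [contactHat, LinearMap.comp_apply, LinearEquiv.coe_coe, LinearEquiv.apply_symm_apply,
    Matrix.mulVecLin_apply, hs, map_smul, hq]
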